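/- **Theorem (Kinematic formula for polyhedral measures).** A polyhedral cone in a Euclidean space $E$ is an intersection of finitely many closed half-spaces $\{x\mid\langle x,a\rangle\le 0\}$; a face of a polyhedral cone $C$ is a set $\{x\in C\mid \langle x,z\rangle=0\}$ with $z\in E$ such that $\langle x,z\rangle\le 0$ for all $x\in C$. Let $\mathcal L_k(C)$ be the (finite) set of linear spans of the $k$-dimensional faces of $C$ (faces whose linear span has dimension $k$). A conic Borel set is a Borel set $M\subseteq E$ with $\lambda M=M$ for all $\lambda>0$. For a polyhedral cone $C$, a conic Borel set $M$ and $k\ge 0$ put $$\Psi_k(C,M)=\sum_{L\in\mathcal L_k(C)}\gamma_L(C\cap L\cap M),\qquad u_k(C)=\sum_{L\in\mathcal L_k(C)}\gamma_L(C\cap L),$$ where $\gamma_L$ is the standard Gaussian measure on $L$ (the Dirac measure at $0$ if $L=\{0\}$); these are $0$ if $k>\dim E$. Let $d,n\ge 0$ be integers, let $C_0,\dots,C_n\subseteq\mathbb R^d$ be polyhedral cones, $M_0,\dots,M_n\subseteq\mathbb R^d$ conic Borel sets, and $T_0,\dots,T_n\in GL_d(\mathbb{R})$. Let $Q_0,\dots,Q_n$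 be independent random elements of $O(d)$, each distributed according to the normalized Haar measure, and let $k>0$ be an integer. Set $C:=C_0\times\cdots\times C_n$ and $M:=M_0\times\cdots\times M_n$, subsets of the Euclidean space $\mathbb R^{(n+1)d}$. Then the random variable below is integrable and $$\mathbb E\Big[\Psi_k\Big(\bigcap_{i=0}^n T_iQ_iC_i,\ \bigcap_{i=0}^n T_iQ_iM_i\Big)\Big]=\Psi_{nd+k}(C,M),$$ where for every $m\ge 0$ the polyhedral measures of the product are given by $$\Psi_m(C,M)=\sum_{i_0+\cdots+i_n=m}\Psi_{i_0}(C_0,M_0)\cdots\Psi_{i_n}(C_n,M_n).$$ In the case $M_0=\cdots=M_n=\mathbb R^d$ this is the kinematic formula for the $u$-vector: $u_k\big(\bigcap_{i=0}^n T_iQ_iC_i\big)$ is integrable and $$\mathbb E\Big[u_k\Big(\bigcap_{i=0}^n T_iQ_iC_i\Big)\Big]=u_{nd+k}(C_0\times\cdots\times C_n).$$ -/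

import Mathlib

open MeasureTheory ProbabilityTheory

noncomputable section

namespace ConicKinematic

section General

variable {E : Type*} [NormedAddCommGroup E] [InnerProductSpace ℝ E]

/-- A polyhedral cone: an intersection of finitely many closed half-spaces `⟪x, a⟫ ≤ 0`. -/
def IsPolyhedralCone (C : Set E) : Prop :=
  ∃ A : Finset E, C = {x | ∀ a ∈ A, inner ℝ x a ≤ 0}

/-- `F` is a face of the cone `C`: it is cut out of `C` by the hyperplane orthogonal to some `z`
that is nonpositive on `C` (`z = 0` gives the face `C` itself). -/
def IsFace (C F : Set E) : Prop :=
  ∃ z : E, (∀ x ∈ C, inner ℝ x z ≤ 0) ∧ F = {x ∈ C | inner ℝ x z = 0}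

/-- The set `𝓛ₖ(C)` of linear spans of the `k`-dimensional faces of `C`. -/
def faceSpans (k : ℕ) (C : Set E) : Set (Submodule ℝ E) :=
  {L | (∃ F, IsFace C F ∧ Submodule.span ℝ F = L) ∧ Module.finrank ℝ L = k}

/-- A conic Borel set: a Borel set `M` with `c M = M` for all `c > 0`. -/
def IsConicBorel [MeasurableSpace E] (M : Set E) : Prop :=
  MeasurableSet M ∧ ∀ c : ℝ, 0 < c → (fun x => c • x) '' M = M

variable [FiniteDimensional ℝ E] [MeasurableSpace E]

/-- `γ_L(A ∩ L)`: the standard Gaussian measure of the subspace `L`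
(the Dirac measure at `0` if `L = 0`), evaluated at the trace of `A` on `L`. -/
def gaussOn (L : Submodule ℝ E) (A : Set E) : ℝ :=
  (stdGaussian L).real {x : L | (x : E) ∈ A}

/-- The polyhedral measure `Ψₖ(C, M) = ∑_{L ∈ 𝓛ₖ(C)} γ_L(C ∩ L ∩ M)`. For a polyhedral cone the
index set is finite; it is empty for `k > dim E`. -/
def polyMeasure (k : ℕ) (C M : Set E) : ℝ :=
  ∑ᶠ L ∈ faceSpans k C, gaussOn L (C ∩ M)

/-- The entry `uₖ(C) = ∑_{L ∈ 𝓛ₖ(C)} γ_L(C ∩ L)` of the `u`-vector. -/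
def uVector (k : ℕ) (C : Set E) : ℝ :=
  ∑ᶠ L ∈ faceSpans k C, gaussOn L C

end General

/-- The product `A 0 × ⋯ × A n` in the Euclidean (`ℓ²`) product of `n + 1` copies of `ℝᵈ`. -/
def prodSet {d n : ℕ} (A : Fin (n + 1) → Set (EuclideanSpace ℝ (Fin d))) :
    Set (PiLp 2 fun _ : Fin (n + 1) => EuclideanSpace ℝ (Fin d)) :=
  {x | ∀ i, x i ∈ A i}

/-- The orthogonal group `O(d)`, with its topology as a set of matrices. -/
abbrev OGroup (d : ℕ) : Type := Matrix.orthogonalGroup (Fin d) ℝ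

instance instMeasurableSpaceOGroup (d : ℕ) : MeasurableSpace (OGroup d) := borel (OGroup d)

instance instBorelSpaceOGroup (d : ℕ) : BorelSpace (OGroup d) := ⟨rfl⟩

theorem compactSpace_OGroup (d : ℕ) : CompactSpace (OGroup d) := by
  refine (isCompact_iff_compactSpace
    (s := ((Matrix.orthogonalGroup (Fin d) ℝ : Submonoid _) : Set (Matrix (Fin d) (Fin d) ℝ)))).mp ?_
  have hK : IsCompact (Set.univ.pi fun _ : Fin d => Set.univ.pi fun _ : Fin d =>
      Set.Icc (-1 : ℝ) 1) :=
    isCompact_univ_pi fun _ => isCompact_univ_pi fun _ => isCompact_Icc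
  refine IsCompact.of_isClosed_subset (X := Matrix (Fin d) (Fin d) ℝ) hK ?_ ?_
  · have h : ((Matrix.orthogonalGroup (Fin d) ℝ : Submonoid _) : Set (Matrix (Fin d) (Fin d) ℝ))
        = {A | star A * A = 1} ∩ {A | A * star A = 1} := by
      ext A
      exact Unitary.mem_iff
    rw [h]
    exact (isClosed_eq (by fun_prop) continuous_const).inter
      (isClosed_eq (by fun_prop) continuous_const)
  · intro A hA i _ j _
    have h := entry_norm_bound_of_unitary hA i j
    rw [Real.norm_eq_abs] at h
    exact abs_le.mp h

instance instCompactSpaceOGroup (d : ℕ) : CompactSpace (OGroup d) := compactSpace_OGroup d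

/-- The uniform distribution on `O(d)`: the Haar measure with total mass `1`. -/
def uniformO (d : ℕ) : Measure (OGroup d) := Measure.haarMeasure ⊤

/-- The image `T Q A` of a set `A ⊆ ℝᵈ` under `T ∈ GL_d` and `Q ∈ O(d)`. -/
def move {d : ℕ} (T : GL (Fin d) ℝ) (Q : OGroup d) (A : Set (EuclideanSpace ℝ (Fin d))) :
    Set (EuclideanSpace ℝ (Fin d)) :=
  (fun x => Matrix.toEuclideanLin (T.val * Q.val) x) '' A

end ConicKinematic

end

/-! For almost every `Q` the subspaces `T i Q i L i`, with `L i` running over the spans of faces of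
`C i`, are in general position. Then the k-faces of the intersection that carry mass come from
tuples of faces whose dimensions add up to `n * d + k`, and the tuple is unique
(`finsum_faceSpans_iInter`). A tuple whose cones meet in less than the whole intersection of spans
need not come from a k-face, but its Gaussian term is zero. So `Ψₖ` of the intersection is almost
surely a finite sum, over an index set independent of `Q`, of the Gaussian measures of `⋂ T i Q i (C
i ∩ M i)` in `V = ⋂ T i Q i L i` (`ae_polyMeasure_iInter_move`).

Each term is averaged by symmetry. Replacing `Q i` by `Q i R i⁻¹` with `R i` preserving `L i`
changes neither the law of `Q` nor `V`, but it rotates the pullback to `L i` of a vector of `V` by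
`R i`. Averaging over independent Haar distributed `R i` makes these pullbacks independent and
uniformly directed in the `L i`, so conic sets are hit with probability `∏ γ_{L i}(C i ∩ M i)`
(`measure_prod_pullback_mem`). The vector must be nonzero, which is where `0 < k` enters.

The same averaging, applied to a hyperplane as conic set, gives general position
(`ae_finrank_movedInter_codim`). The right-hand side is the polyhedral measure of the product
because faces of a product are products of faces and Gaussian measures multiply. -/

noncomputable section

set_option linter.unusedSectionVars false

namespace ConicKinematic

/-! ### Faces of polyhedral cones: active inequalities, intersections, linear images. -/

section Faces

variable {E : Type*} [NormedAddCommGroup E] [InnerProductSpace ℝ E]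

/-- The linear spans of all faces of `C`, of any dimension. -/
def allSpans (C : Set E) : Set (Submodule ℝ E) :=
  {L | ∃ F, IsFace C F ∧ Submodule.span ℝ F = L}

theorem mem_faceSpans_iff {k : ℕ} {C : Set E} {L : Submodule ℝ E} :
    L ∈ faceSpans k C ↔ L ∈ allSpans C ∧ Module.finrank ℝ L = k := Iff.rfl

/-- The cone cut out by the inequalities `⟪x, a⟫ ≤ 0` for `a ∈ A`. -/
def coneOf (A : Finset E) : Set E := {x | ∀ a ∈ A, inner ℝ x a ≤ 0}

theorem IsPolyhedralCone.exists_coneOf {C : Set E} (hC : IsPolyhedralCone C) :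
    ∃ A : Finset E, C = coneOf A := hC

theorem zero_mem_coneOf (A : Finset E) : (0 : E) ∈ coneOf A := fun a _ => by simp

theorem sum_mem_coneOf {A : Finset E} {κ : Type*} (s : Finset κ) {f : κ → E}
    (hf : ∀ i ∈ s, f i ∈ coneOf A) : ∑ i ∈ s, f i ∈ coneOf A := fun a ha => by
  rw [sum_inner]
  exact Finset.sum_nonpos fun i hi => hf i hi a ha

theorem zero_mem_of_isFace {C F : Set E} (h0 : (0 : E) ∈ C) (hF : IsFace C F) : (0 : E) ∈ F := by
  obtain ⟨z, -, rfl⟩ := hF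
  exact ⟨h0, by simp⟩

theorem IsFace.subset {C F : Set E} (hF : IsFace C F) : F ⊆ C := by
  obtain ⟨z, -, rfl⟩ := hF
  exact fun x hx => hx.1

/-- The supporting hyperplane contains `F`, hence its span. So a face is determined by its span, and
working with spans loses nothing. -/
theorem IsFace.eq_inter_span {C F : Set E} (hF : IsFace C F) :
    F = C ∩ (Submodule.span ℝ F : Set E) := by
  refine Set.Subset.antisymm (fun x hx => ⟨hF.subset hx, Submodule.subset_span hx⟩) ?_
  obtain ⟨z, -, rfl⟩ := hF
  rintro x ⟨hx, hxs⟩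
  refine ⟨hx, ?_⟩
  have : Submodule.span ℝ {x ∈ C | inner ℝ x z = 0} ≤ (Submodule.span ℝ {z})ᗮ := by
    rw [Submodule.span_le]
    rintro y ⟨-, hy⟩
    exact Submodule.mem_orthogonal_singleton_iff_inner_left.2 hy
  exact Submodule.mem_orthogonal_singleton_iff_inner_left.1 (this hxs)

theorem isFace_inter_of_mem_allSpans {C : Set E} {L : Submodule ℝ E} (hL : L ∈ allSpans C) :
    IsFace C (C ∩ L) ∧ Submodule.span ℝ (C ∩ L) = L := by
  obtain ⟨F, hF, rfl⟩ := hL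
  rw [← hF.eq_inter_span]
  exact ⟨hF, rfl⟩

/-- The sum of the supporting vectors works: nonpositive numbers add up to zero only if each of them
is zero. -/
theorem isFace_iInter {ι : Type*} [Fintype ι] {C F : ι → Set E} (h : ∀ i, IsFace (C i) (F i)) :
    IsFace (⋂ i, C i) (⋂ i, F i) := by
  choose z hz hF using h
  refine ⟨∑ i, z i, fun x hx => ?_, ?_⟩
  · rw [inner_sum]
    exact Finset.sum_nonpos fun i _ => hz i x (Set.mem_iInter.1 hx i)
  · ext x
    simp only [hF, Set.mem_iInter, Set.mem_ofPred_eq, inner_sum]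
    constructor
    · intro hx
      exact ⟨fun i => (hx i).1, Finset.sum_eq_zero fun i _ => (hx i).2⟩
    · rintro ⟨hx, h0⟩ i
      exact ⟨hx i, (Finset.sum_eq_zero_iff_of_nonpos fun j _ => hz j x (hx j)).1 h0 i
        (Finset.mem_univ i)⟩

theorem isFace_active (A B : Finset E) (hB : B ⊆ A) :
    IsFace (coneOf A) {y ∈ coneOf A | ∀ a ∈ B, inner ℝ y a = 0} := by
  refine ⟨∑ a ∈ B, a, fun x hx => ?_, ?_⟩
  · rw [inner_sum]
    exact Finset.sum_nonpos fun a ha => hx a (hB ha)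
  · ext x
    simp only [Set.mem_ofPred_eq, inner_sum]
    refine and_congr_right fun hx => ?_
    rw [Finset.sum_eq_zero_iff_of_nonpos fun a ha => hx a (hB ha)]

theorem exists_add_smul_mem_coneOf {A B : Finset E} {x v : E} (hx : x ∈ coneOf A)
    (hlt : ∀ a ∈ A, a ∉ B → inner ℝ x a < 0) (hv : ∀ a ∈ B, inner ℝ v a = 0) :
    ∃ ε : ℝ, 0 < ε ∧ x + ε • v ∈ coneOf A := by
  have key : ∀ᶠ ε : ℝ in nhdsWithin 0 (Set.Ioi 0), ∀ a ∈ A, inner ℝ (x + ε • v) a ≤ 0 := by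
    rw [Filter.eventually_all_finset]
    intro a ha
    by_cases haB : a ∈ B
    · refine Filter.Eventually.of_forall fun ε => ?_
      rw [inner_add_left, inner_smul_left, hv a haB]
      simpa using hx a ha
    · have hc : Continuous fun ε : ℝ => (inner ℝ (x + ε • v) a : ℝ) := by fun_prop
      have : ∀ᶠ ε : ℝ in nhds 0, inner ℝ (x + ε • v) a < (0 : ℝ) :=
        hc.continuousAt.eventually_lt continuousAt_const (by simpa using hlt a ha haB)
      exact (this.filter_mono nhdsWithin_le_nhds).mono fun ε h => h.le
  obtain ⟨ε, h1, h2⟩ := (key.and self_mem_nhdsWithin).exists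
  exact ⟨ε, h2, h1⟩

/-- The point `x` is relatively interior: from it one can move a little in every direction
orthogonal to `B` without leaving the cone. -/
theorem span_active {A B : Finset E} {x : E}
    (hx : x ∈ {y ∈ coneOf A | ∀ a ∈ B, inner ℝ y a = 0})
    (hlt : ∀ a ∈ A, a ∉ B → inner ℝ x a < 0) :
    Submodule.span ℝ {y ∈ coneOf A | ∀ a ∈ B, inner ℝ y a = 0}
      = (Submodule.span ℝ (B : Set E))ᗮ := by
  have hmem : ∀ v : E, v ∈ (Submodule.span ℝ (B : Set E))ᗮ ↔ ∀ a ∈ B, inner ℝ v a = 0 := by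
    intro v
    rw [Submodule.mem_orthogonal']
    refine ⟨fun h a ha => h a (Submodule.subset_span ha), fun h u hu => ?_⟩
    induction hu using Submodule.span_induction with
    | mem u hu => exact h u hu
    | zero => simp
    | add u w _ _ h1 h2 => rw [inner_add_right, h1, h2, add_zero]
    | smul c u _ h1 => rw [inner_smul_right, h1, mul_zero]
  apply le_antisymm
  · rw [Submodule.span_le]
    rintro y ⟨-, hy⟩
    exact (hmem y).2 hy
  · intro v hv
    rw [hmem] at hv
    obtain ⟨ε, hε, hmemε⟩ := exists_add_smul_mem_coneOf hx.1 hlt hv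
    have h1 : x + ε • v ∈ Submodule.span ℝ {y ∈ coneOf A | ∀ a ∈ B, inner ℝ y a = 0} :=
      Submodule.subset_span ⟨hmemε, fun a ha => by
        rw [inner_add_left, inner_smul_left, hv a ha, hx.2 a ha]; simp⟩
    have h2 := Submodule.sub_mem _ h1 (Submodule.subset_span hx)
    rw [add_sub_cancel_left] at h2
    simpa [smul_smul, hε.ne'] using Submodule.smul_mem _ ε⁻¹ h2

/-- A face of a polyhedral cone is cut out by its active inequalities, and it contains a point at
which the others are strict. -/
theorem exists_active {A : Finset E} {F : Set E} (hF : IsFace (coneOf A) F) :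
    ∃ B ⊆ A, F = {y ∈ coneOf A | ∀ a ∈ B, inner ℝ y a = 0} ∧
      ∃ x ∈ F, ∀ a ∈ A, a ∉ B → inner ℝ x a < 0 := by
  classical
  have hFC := hF.subset
  have h0 := zero_mem_of_isFace (zero_mem_coneOf A) hF
  set B := A.filter fun a => ∀ y ∈ F, inner ℝ y a = 0 with hBdef
  have hw : ∀ a : E, ∃ y ∈ F, a ∈ A → a ∉ B → inner ℝ y a < 0 := by
    intro a
    by_cases h : a ∈ A ∧ a ∉ B
    · have : ∃ y ∈ F, inner ℝ y a ≠ 0 := by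
        by_contra! hcon
        exact h.2 (Finset.mem_filter.2 ⟨h.1, hcon⟩)
      obtain ⟨y, hy, hne⟩ := this
      exact ⟨y, hy, fun _ _ => lt_of_le_of_ne (hFC hy a h.1) hne⟩
    · exact ⟨0, h0, fun h1 h2 => absurd ⟨h1, h2⟩ h⟩
  choose w hwF hwlt using hw
  obtain ⟨z, hz, hFz⟩ := id hF
  -- Summing the witnesses gives a single point of `F` at which every inactive inequality is strict.
  have hxF : ∑ a ∈ A, w a ∈ F := by
    rw [hFz]
    refine ⟨sum_mem_coneOf A fun a _ => hFC (hwF a), ?_⟩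
    rw [sum_inner]
    refine Finset.sum_eq_zero fun a _ => ?_
    have := hwF a
    rw [hFz] at this
    exact this.2
  have hlt : ∀ a ∈ A, a ∉ B → inner ℝ (∑ a ∈ A, w a) a < 0 := by
    intro a ha haB
    rw [sum_inner]
    exact Finset.sum_neg' (fun b _ => hFC (hwF b) a ha) ⟨a, ha, hwlt a ha haB⟩
  refine ⟨B, Finset.filter_subset _ _, ?_, _, hxF, hlt⟩
  apply Set.Subset.antisymm
  · exact fun y hy => ⟨hFC hy, fun a ha => (Finset.mem_filter.1 ha).2 y hy⟩
  · rintro y ⟨hyC, hyB⟩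
    -- The interior point can be pushed slightly away from `y` inside the cone; testing against `z`
    -- gives `⟪y, z⟫ ≥ 0`.
    obtain ⟨ε, hε, hmem⟩ := exists_add_smul_mem_coneOf (v := -y) (hFC hxF) hlt
      fun a ha => by simp [hyB a ha]
    have h1 := hz _ hmem
    have h2 := hz _ hyC
    have h3 : inner ℝ (∑ a ∈ A, w a) z = 0 := by
      rw [hFz] at hxF
      exact hxF.2
    rw [inner_add_left, inner_smul_left, inner_neg_left, h3] at h1
    rw [hFz]
    refine ⟨hyC, le_antisymm h2 ?_⟩
    simp only [conj_trivial, zero_add, mul_neg, Left.neg_nonpos_iff] at h1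
    exact nonneg_of_mul_nonneg_right h1 hε

theorem finite_allSpans {C : Set E} (hC : IsPolyhedralCone C) : (allSpans C).Finite := by
  obtain ⟨A, rfl⟩ := hC.exists_coneOf
  refine ((Finset.finite_toSet A.powerset).image
    fun B : Finset E => (Submodule.span ℝ (B : Set E))ᗮ).subset ?_
  rintro L ⟨F, hF, rfl⟩
  obtain ⟨B, hBA, hFB, x, hx, hlt⟩ := exists_active hF
  refine ⟨B, by simpa using hBA, ?_⟩
  rw [hFB] at hx ⊢
  exact (span_active hx hlt).symm

theorem exists_iInf_of_mem_allSpans {ι : Type*} [Fintype ι] {C : ι → Set E}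
    (hC : ∀ i, IsPolyhedralCone (C i)) {L : Submodule ℝ E} (hL : L ∈ allSpans (⋂ i, C i)) :
    ∃ K : ι → Submodule ℝ E, (∀ i, K i ∈ allSpans (C i)) ∧ L = ⨅ i, K i := by
  classical
  choose A hA using fun i => (hC i).exists_coneOf
  have hD : ⋂ i, C i = coneOf (Finset.univ.biUnion A) := by
    ext x
    simp only [hA, coneOf, Set.mem_iInter, Set.mem_ofPred_eq, Finset.mem_biUnion, Finset.mem_univ,
      true_and, forall_exists_index]
    exact ⟨fun h a i ha => h i a ha, fun h i a ha => h a i ha⟩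
  rw [hD] at hL
  obtain ⟨F, hF, rfl⟩ := hL
  obtain ⟨B, hBA, hFB, x, hx, hlt⟩ := exists_active hF
  have hspan : Submodule.span ℝ F = (Submodule.span ℝ (B : Set E))ᗮ := by
    rw [hFB] at hx ⊢
    exact span_active hx hlt
  have hxC : ∀ i, x ∈ coneOf (A i) := fun i a ha =>
    hF.subset hx a (Finset.mem_biUnion.2 ⟨i, Finset.mem_univ i, ha⟩)
  -- The active set `B` is split according to the cone each inequality comes from; the same `x` is
  -- an interior point for every resulting face.
  refine ⟨fun i => (Submodule.span ℝ ((B ∩ A i : Finset E) : Set E))ᗮ, fun i => ?_, ?_⟩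
  · rw [hA i]
    refine ⟨_, isFace_active (A i) (B ∩ A i) Finset.inter_subset_right, span_active (x := x) ?_ ?_⟩
    · refine ⟨hxC i, fun a ha => ?_⟩
      rw [hFB] at hx
      exact hx.2 a (Finset.mem_inter.1 ha).1
    · exact fun a ha haB => hlt a (Finset.mem_biUnion.2 ⟨i, Finset.mem_univ i, ha⟩)
        fun h => haB (Finset.mem_inter.2 ⟨h, ha⟩)
  · rw [hspan, Submodule.iInf_orthogonal, ← Submodule.span_iUnion]
    congr 2
    ext a
    simp only [Finset.mem_coe, Set.mem_iUnion, Finset.mem_inter]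
    refine ⟨fun h => ?_, fun ⟨i, h⟩ => h.1⟩
    obtain ⟨i, -, hi⟩ := Finset.mem_biUnion.1 (hBA h)
    exact ⟨i, h, hi⟩

section Image

variable [CompleteSpace E]

/-- Normal vectors transform by the inverse adjoint. -/
theorem inner_map_adjoint_symm (g : E ≃L[ℝ] E) (x z : E) :
    inner ℝ (g x) (ContinuousLinearMap.adjoint (g.symm : E →L[ℝ] E) z) = inner ℝ x z := by
  rw [ContinuousLinearMap.adjoint_inner_right]
  simp

theorem IsPolyhedralCone.image {C : Set E} (hC : IsPolyhedralCone C) (g : E ≃L[ℝ] E) :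
    IsPolyhedralCone (g '' C) := by
  classical
  obtain ⟨A, rfl⟩ := hC
  refine ⟨A.image (ContinuousLinearMap.adjoint (g.symm : E →L[ℝ] E)), ?_⟩
  ext y
  obtain ⟨x, rfl⟩ := g.surjective y
  rw [g.injective.mem_set_image]
  simp [inner_map_adjoint_symm]

theorem IsFace.image {C F : Set E} (hF : IsFace C F) (g : E ≃L[ℝ] E) :
    IsFace (g '' C) (g '' F) := by
  obtain ⟨z, hz, rfl⟩ := hF
  refine ⟨ContinuousLinearMap.adjoint (g.symm : E →L[ℝ] E) z, ?_, ?_⟩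
  · rintro _ ⟨x, hx, rfl⟩
    rw [inner_map_adjoint_symm]
    exact hz x hx
  · ext y
    obtain ⟨x, rfl⟩ := g.surjective y
    simp [inner_map_adjoint_symm, g.injective.mem_set_image]

theorem map_mem_allSpans_image {C : Set E} {L : Submodule ℝ E} (hL : L ∈ allSpans C)
    (g : E ≃L[ℝ] E) : L.map (g : E →ₗ[ℝ] E) ∈ allSpans (g '' C) := by
  obtain ⟨F, hF, rfl⟩ := hL
  exact ⟨_, hF.image g, by rw [Submodule.map_span]; rfl⟩

theorem exists_map_of_mem_allSpans_image {C : Set E} (g : E ≃L[ℝ] E) {L : Submodule ℝ E}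
    (hL : L ∈ allSpans (g '' C)) : ∃ K ∈ allSpans C, L = K.map (g : E →ₗ[ℝ] E) := by
  refine ⟨L.map (g.symm : E →ₗ[ℝ] E), ?_, ?_⟩
  · have := map_mem_allSpans_image hL g.symm
    rwa [← Set.image_comp, g.symm_comp_self, Set.image_id] at this
  · ext x
    simp only [Submodule.mem_map]
    constructor
    · exact fun hx => ⟨g.symm x, ⟨x, hx, rfl⟩, by simp⟩
    · rintro ⟨_, ⟨y, hy, rfl⟩, rfl⟩
      simpa using hy

end Image

end Faces

/-! ### Faces of an intersection in general position. -/

section GenericIntersection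

variable {E : Type*} [NormedAddCommGroup E] [InnerProductSpace ℝ E] [FiniteDimensional ℝ E]

/-- The tuples of spans of faces of the `C i` with prescribed sum of dimensions. -/
def spanTuples {ι : Type*} [Fintype ι] (m : ℕ) (C : ι → Set E) : Set (ι → Submodule ℝ E) :=
  {K | (∀ i, K i ∈ allSpans (C i)) ∧ ∑ i, Module.finrank ℝ (K i) = m}

theorem finite_spanTuples {ι : Type*} [Fintype ι] (m : ℕ) {C : ι → Set E}
    (hC : ∀ i, IsPolyhedralCone (C i)) : (spanTuples m C).Finite :=
  (Set.Finite.pi' fun i => finite_allSpans (hC i)).subset fun _ hK => hK.1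

/-- If the spans of the faces of the `C i` and their pairwise intersections are in general
position, then the `k`-dimensional faces of the intersection correspond to tuples of faces. -/
theorem finsum_faceSpans_iInter {ι : Type*} [Fintype ι] {C : ι → Set E}
    (hC : ∀ i, IsPolyhedralCone (C i)) {k N : ℕ} (hk : 0 < k)
    (hgen : ∀ K K' : ι → Submodule ℝ E, (∀ i, K i ∈ allSpans (C i)) →
      (∀ i, K' i ∈ allSpans (C i)) →
      Module.finrank ℝ (⨅ i, K i ⊓ K' i : Submodule ℝ E)
        = ∑ i, Module.finrank ℝ (K i ⊓ K' i : Submodule ℝ E) - N)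
    (g : Submodule ℝ E → ℝ)
    (hg : ∀ L, g L ≠ 0 → Submodule.span ℝ ((⋂ i, C i) ∩ (L : Set E)) = L) :
    ∑ᶠ L ∈ faceSpans k (⋂ i, C i), g L = ∑ᶠ K ∈ spanTuples (N + k) C, g (⨅ i, K i) := by
  have hgen' : ∀ K : ι → Submodule ℝ E, (∀ i, K i ∈ allSpans (C i)) →
      Module.finrank ℝ (⨅ i, K i : Submodule ℝ E) = ∑ i, Module.finrank ℝ (K i) - N := by
    intro K hK
    have h := hgen K K hK hK
    rw [iInf_inf_eq, inf_idem] at h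
    rw [h]
    congr 1
    exact Finset.sum_congr rfl fun i _ =>
      congrArg (fun S : Submodule ℝ E => Module.finrank ℝ S) (inf_idem (K i))
  -- Only where `g` is nonzero do the two index sets correspond, so both sums are first restricted
  -- to the support.
  rw [← finsum_mem_inter_support, ← finsum_mem_inter_support
    (fun K : ι → Submodule ℝ E => g (⨅ i, K i)) (spanTuples (N + k) C)]
  symm
  refine finsum_mem_eq_of_bijOn (fun K : ι → Submodule ℝ E => ⨅ i, K i) ⟨?_, ?_, ?_⟩
    fun K _ => rfl
  · rintro K ⟨⟨hK, hsum⟩, hne⟩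
    refine ⟨⟨⟨_, ?_, hg _ hne⟩, ?_⟩, hne⟩
    · have := isFace_iInter fun i => (isFace_inter_of_mem_allSpans (hK i)).1
      rwa [Set.iInter_inter_distrib, ← Submodule.coe_iInf] at this
    · rw [hgen' K hK, hsum]
      omega
  -- If two tuples have the same intersection, general position of the tuple `K i ⊓ K' i` forces its
  -- dimensions to sum to `N + k` again, so nothing is lost in any factor. As `k > 0`, the truncated
  -- subtraction is a genuine one.
  · rintro K ⟨⟨hK, hsum⟩, hne⟩ K' ⟨⟨hK', hsum'⟩, hne'⟩ (heq : ⨅ i, K i = ⨅ i, K' i)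
    have h1 := hgen' K hK
    have h2 := hgen K K' hK hK'
    rw [iInf_inf_eq, ← heq, inf_idem, h1, hsum] at h2
    have hle : ∀ i, Module.finrank ℝ (K i ⊓ K' i : Submodule ℝ E) ≤ Module.finrank ℝ (K i) :=
      fun i => Submodule.finrank_mono inf_le_left
    have hle' : ∀ i, Module.finrank ℝ (K i ⊓ K' i : Submodule ℝ E) ≤ Module.finrank ℝ (K' i) :=
      fun i => Submodule.finrank_mono inf_le_right
    have e1 : ∑ i, Module.finrank ℝ (K i ⊓ K' i : Submodule ℝ E)
        = ∑ i, Module.finrank ℝ (K i) := by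
      have := Finset.sum_le_sum fun i (_ : i ∈ Finset.univ) => hle i
      omega
    have e2 := e1.trans (hsum.trans hsum'.symm)
    rw [Finset.sum_eq_sum_iff_of_le fun i _ => hle i] at e1
    rw [Finset.sum_eq_sum_iff_of_le fun i _ => hle' i] at e2
    funext i
    rw [← Submodule.eq_of_le_of_finrank_eq inf_le_left (e1 i (Finset.mem_univ i))]
    exact Submodule.eq_of_le_of_finrank_eq inf_le_right (e2 i (Finset.mem_univ i))
  · rintro L ⟨⟨hL, hdim⟩, hne⟩
    obtain ⟨K, hK, rfl⟩ := exists_iInf_of_mem_allSpans hC hL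
    refine ⟨K, ⟨⟨hK, ?_⟩, hne⟩, rfl⟩
    have := hgen' K hK
    omega

end GenericIntersection

/-! ### Gaussian measures on subspaces and on products. -/

section Gaussian

variable {E : Type*} [NormedAddCommGroup E] [InnerProductSpace ℝ E] [FiniteDimensional ℝ E]
  [MeasurableSpace E] [BorelSpace E]

/-- A proper subspace lies in some hyperplane `v^⊥`, and `⟪v, ·⟫` is a nondegenerate real Gaussian,
which has no atoms. -/
theorem stdGaussian_submodule_eq_zero {K : Submodule ℝ E} (hK : K ≠ ⊤) :
    stdGaussian E (K : Set E) = 0 := by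
  obtain ⟨v, hv, hv0⟩ := Submodule.exists_mem_ne_zero_of_ne_bot
    (mt Submodule.orthogonal_eq_bot_iff.1 hK)
  have hsub : (K : Set E) ⊆ (innerSL ℝ v) ⁻¹' {0} := fun x hx => by
    simpa using (Submodule.mem_orthogonal' K v).1 hv x hx
  refine measure_mono_null hsub ?_
  rw [← Measure.map_apply (innerSL ℝ v).continuous.measurable (measurableSet_singleton 0),
    IsGaussian.map_eq_gaussianReal, variance_dual_stdGaussian]
  have : NullSingletonClass (gaussianReal (∫ x, innerSL ℝ v x ∂stdGaussian E)
      (‖innerSL ℝ v‖ ^ 2).toNNReal) := by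
    apply nullSingletonClass_gaussianReal
    simpa using hv0
  exact measure_singleton 0

theorem map_orthogonalProjectionOnto_stdGaussian (L : Submodule ℝ E) :
    (stdGaussian E).map L.orthogonalProjectionOnto = stdGaussian L := by
  have : IsFiniteMeasure ((stdGaussian E).map L.orthogonalProjectionOnto) := inferInstance
  apply Measure.ext_of_charFunDual
  ext ℓ
  rw [charFunDual_map, charFunDual_stdGaussian, charFunDual_stdGaussian]
  have : ‖ℓ.comp L.orthogonalProjectionOnto‖ = ‖ℓ‖ := by
    apply le_antisymm
    · refine (ContinuousLinearMap.opNorm_comp_le _ _).trans ?_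
      exact mul_le_of_le_one_right (norm_nonneg _) L.orthogonalProjectionOnto_norm_le
    · refine ContinuousLinearMap.opNorm_le_bound _ (norm_nonneg _) fun x => ?_
      have := (ℓ.comp L.orthogonalProjectionOnto).le_opNorm (x : E)
      simpa using this
  rw [this]

theorem measurableSet_trace {A : Set E} (hA : MeasurableSet A) (L : Submodule ℝ E) :
    MeasurableSet {x : L | (x : E) ∈ A} := measurable_subtype_coe hA

/-- This trades the measure on the varying space `L` for a fixed measure on `E` and a varying
projection, so that Fubini applies when `L` is random. -/
theorem stdGaussian_trace (L : Submodule ℝ E) {A : Set E} (hA : MeasurableSet A) :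
    stdGaussian L {x : L | (x : E) ∈ A} = stdGaussian E {x | L.starProjection x ∈ A} := by
  rw [← map_orthogonalProjectionOnto_stdGaussian,
    Measure.map_apply L.orthogonalProjectionOnto.continuous.measurable (measurableSet_trace hA L)]
  rfl

/-- Otherwise the trace of `A` on `L` would lie in a proper subspace of `L`, a null set. This
discards the tuples of faces that meet degenerately. -/
theorem span_eq_of_gaussOn_ne_zero {L : Submodule ℝ E} {A : Set E} (h : gaussOn L A ≠ 0) :
    Submodule.span ℝ (A ∩ (L : Set E)) = L := by
  apply le_antisymm (Submodule.span_le.2 Set.inter_subset_right)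
  by_contra hcon
  apply h
  have : stdGaussian L ((Submodule.span ℝ (A ∩ (L : Set E))).comap L.subtype : Set L) = 0 :=
    stdGaussian_submodule_eq_zero fun htop => hcon (Submodule.comap_subtype_eq_top.1 htop)
  rw [gaussOn, measureReal_def, measure_mono_null _ this, ENNReal.toReal_zero]
  exact fun x hx => Submodule.subset_span ⟨hx, x.2⟩

theorem ae_starProjection_ne_zero {L : Submodule ℝ E} (hL : L ≠ ⊥) :
    ∀ᵐ x ∂stdGaussian E, L.starProjection x ≠ 0 := by
  have : stdGaussian E (Lᗮ : Set E) = 0 :=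
    stdGaussian_submodule_eq_zero fun h => hL ((Submodule.orthogonal_eq_top_iff _).1 h)
  filter_upwards [measure_eq_zero_iff_ae_notMem.1 this] with x hx h0
  apply hx
  exact Submodule.starProjection_apply_eq_zero_iff L |>.1 h0

section Pi

variable {ι : Type*} [Fintype ι]

theorem map_pi_stdGaussian :
    (Measure.pi fun _ : ι => stdGaussian E).map (WithLp.toLp 2)
      = stdGaussian (PiLp 2 fun _ : ι => E) := by
  apply Measure.ext_of_charFun
  ext t
  simp_rw [charFun_stdGaussian, charFun_pi, charFun_stdGaussian, ← Complex.exp_sum,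
    ← Complex.ofReal_pow, PiLp.norm_sq_eq_of_L2]
  congr 1
  push_cast
  rw [← Finset.sum_neg_distrib, Finset.sum_div]

/-- The submodule of the Euclidean product whose components lie in the `L i`. -/
def piSubmodule (L : ι → Submodule ℝ E) : Submodule ℝ (PiLp 2 fun _ : ι => E) where
  carrier := {x | ∀ i, x i ∈ L i}
  zero_mem' := fun i => by simp
  add_mem' := fun hx hy i => by simpa using (L i).add_mem (hx i) (hy i)
  smul_mem' := fun c x hx i => by simpa using (L i).smul_mem c (hx i)

theorem starProjection_piSubmodule (L : ι → Submodule ℝ E) (x : PiLp 2 fun _ : ι => E) :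
    (piSubmodule L).starProjection x = WithLp.toLp 2 fun i => (L i).starProjection (x i) := by
  apply Submodule.eq_starProjection_of_mem_of_inner_eq_zero
  · intro i
    exact Submodule.starProjection_apply_mem _ _
  · intro w hw
    rw [PiLp.inner_apply]
    exact Finset.sum_eq_zero fun i _ =>
      Submodule.starProjection_inner_eq_zero (K := L i) (x i) (w i) (hw i)

theorem finrank_piSubmodule (L : ι → Submodule ℝ E) :
    Module.finrank ℝ (piSubmodule L) = ∑ i, Module.finrank ℝ (L i) := by
  rw [← Module.finrank_pi_fintype]
  exact LinearEquiv.finrank_eq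
    { toFun := fun x i => ⟨x.1 i, x.2 i⟩
      map_add' := fun x y => rfl
      map_smul' := fun c x => rfl
      invFun := fun y => ⟨WithLp.toLp 2 fun i => (y i : E), fun i => (y i).2⟩
      left_inv := fun x => rfl
      right_inv := fun y => rfl }

/-- The projection onto the product subspace acts componentwise, and the standard Gaussian of the ℓ²
product is the product measure. -/
theorem gaussOn_piSubmodule (L : ι → Submodule ℝ E) {A : ι → Set E}
    (hA : ∀ i, MeasurableSet (A i)) :
    gaussOn (piSubmodule L) {x : PiLp 2 fun _ : ι => E | ∀ i, x i ∈ A i}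
      = ∏ i, gaussOn (L i) (A i) := by
  have hm : MeasurableSet {x : PiLp 2 fun _ : ι => E | ∀ i, x i ∈ A i} := by
    rw [Set.ofPred_forall]
    refine MeasurableSet.iInter fun i => ?_
    have : Measurable fun x : PiLp 2 fun _ : ι => E => x i := by fun_prop
    exact this (hA i)
  have hP : Measurable ((piSubmodule L).starProjection) :=
    (piSubmodule L).starProjection.continuous.measurable
  simp_rw [gaussOn, measureReal_def, ← ENNReal.toReal_prod]
  rw [stdGaussian_trace _ hm, ← map_pi_stdGaussian, ← Set.preimage_ofPred_eq, Set.ofPred_mem_eq,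
    Measure.map_apply (by fun_prop) (measurableSet_preimage hP hm)]
  congr 1
  simp_rw [fun i => stdGaussian_trace (L i) (hA i)]
  rw [← Measure.pi_pi]
  congr 1
  ext x
  simp [starProjection_piSubmodule]

end Pi

end Gaussian

/-! ### Measurable dependence of the projection onto a kernel. -/

section MeasurableProjection

variable {E F : Type*} [NormedAddCommGroup E] [InnerProductSpace ℝ E] [FiniteDimensional ℝ E]
  [NormedAddCommGroup F] [InnerProductSpace ℝ F] [FiniteDimensional ℝ F]

/-- A contraction of `E` whose fixed vectors form the kernel of `A`. -/
def kerContraction (A : E →L[ℝ] F) : E →L[ℝ] E :=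
  1 - (1 + ‖A‖ ^ 2)⁻¹ • (ContinuousLinearMap.adjoint A ∘L A)

theorem kerContraction_apply (A : E →L[ℝ] F) (x : E) :
    kerContraction A x = x - (1 + ‖A‖ ^ 2)⁻¹ • ContinuousLinearMap.adjoint A (A x) := rfl

/-- With `c = (1 + ‖A‖²)⁻¹`, the squared norm of the image of `x` is `‖x‖² - 2c‖Ax‖² + c²‖A*Ax‖²`,
and `c‖A‖² ≤ 1` makes the last term at most `c‖Ax‖²`. -/
theorem norm_kerContraction_le (A : E →L[ℝ] F) : ‖kerContraction A‖ ≤ 1 := by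
  refine ContinuousLinearMap.opNorm_le_bound _ zero_le_one fun x => ?_
  rw [one_mul]
  refine le_of_sq_le_sq ?_ (norm_nonneg _)
  rw [kerContraction_apply, norm_sub_sq_real, inner_smul_right,
    ContinuousLinearMap.adjoint_inner_right, real_inner_self_eq_norm_sq, norm_smul, mul_pow]
  set c : ℝ := (1 + ‖A‖ ^ 2)⁻¹ with hc
  have hc0 : 0 < c := by positivity
  have h1 : ‖ContinuousLinearMap.adjoint A (A x)‖ ^ 2 ≤ ‖A‖ ^ 2 * ‖A x‖ ^ 2 := by
    rw [← mul_pow]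
    refine pow_le_pow_left₀ (norm_nonneg _) ?_ 2
    simpa using (ContinuousLinearMap.adjoint A).le_opNorm (A x)
  have h2 : c * ‖A‖ ^ 2 ≤ 1 := by
    rw [hc, inv_mul_le_iff₀ (by positivity)]
    linarith
  have h3 : ‖c‖ ^ 2 * ‖ContinuousLinearMap.adjoint A (A x)‖ ^ 2 ≤ c * ‖A x‖ ^ 2 := by
    rw [Real.norm_of_nonneg hc0.le]
    calc c ^ 2 * ‖ContinuousLinearMap.adjoint A (A x)‖ ^ 2
        ≤ c ^ 2 * (‖A‖ ^ 2 * ‖A x‖ ^ 2) := by gcongr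
      _ = (c * ‖A x‖ ^ 2) * (c * ‖A‖ ^ 2) := by ring
      _ ≤ c * ‖A x‖ ^ 2 := mul_le_of_le_one_right (by positivity) h2
  have h4 : 0 ≤ c * ‖A x‖ ^ 2 := by positivity
  linarith

theorem eqLocus_kerContraction (A : E →L[ℝ] F) :
    (kerContraction A).eqLocus (1 : E →L[ℝ] E) = A.ker := by
  ext x
  have hc : (1 + ‖A‖ ^ 2)⁻¹ ≠ 0 := by positivity
  change kerContraction A x = x ↔ A x = 0
  rw [kerContraction_apply, sub_eq_self, smul_eq_zero, or_iff_right hc]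
  refine ⟨fun h => ?_, fun h => by rw [h, map_zero]⟩
  have := ContinuousLinearMap.adjoint_inner_right A x (A x)
  rwa [h, inner_zero_right, eq_comm, inner_self_eq_zero] at this

omit [FiniteDimensional ℝ E] in
theorem starProjection_congr {K L : Submodule ℝ E} [K.HasOrthogonalProjection]
    [L.HasOrthogonalProjection] (h : K = L) (x : E) :
    K.starProjection x = L.starProjection x := by
  subst h
  rfl

/-- This is von Neumann's mean ergodic theorem: the averages of a contraction converge to the
projection onto its fixed space. -/
theorem tendsto_starProjection_ker (A : E →L[ℝ] F) (x : E) :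
    Filter.Tendsto (birkhoffAverage ℝ (kerContraction A) _root_.id · x) Filter.atTop
      (nhds (A.ker.starProjection x)) := by
  have := (kerContraction A).tendsto_birkhoffAverage_orthogonalProjection
    (norm_kerContraction_le A) x
  rw [starProjection_congr (eqLocus_kerContraction A).symm x]
  exact this

variable [MeasurableSpace E] [BorelSpace E]

/-- The projection can jump with the dimension of the kernel, but it is a pointwise limit of ergodic
averages that are jointly continuous in the parameter and the vector. -/
theorem measurable_starProjection_ker {X : Type*} [TopologicalSpace X] [MeasurableSpace X]
    [OpensMeasurableSpace X] {A : X → E →L[ℝ] F} (hA : Continuous A) :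
    Measurable fun p : X × E => (A p.1).ker.starProjection p.2 := by
  have hf : Continuous fun q : X => kerContraction (A q) := by
    unfold kerContraction
    have h1 : Continuous fun q : X => (1 + ‖A q‖ ^ 2)⁻¹ :=
      Continuous.inv₀ (by fun_prop) fun q => by positivity
    have h2 : Continuous fun q : X => ContinuousLinearMap.adjoint (A q) :=
      (ContinuousLinearMap.adjoint (𝕜 := ℝ) (E := E) (F := F)).continuous.comp hA
    exact continuous_const.sub (h1.smul (h2.clm_comp hA))
  have hiter : ∀ n : ℕ, Continuous fun p : X × E => (kerContraction (A p.1))^[n] p.2 := by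
    intro n
    induction n with
    | zero => exact continuous_snd
    | succ n ih =>
      simp_rw [Function.iterate_succ_apply']
      exact (hf.comp continuous_fst).clm_apply ih
  refine measurable_of_tendsto_metrizable
    (f := fun n (p : X × E) => birkhoffAverage ℝ (kerContraction (A p.1)) _root_.id n p.2)
    (fun n => Continuous.measurable ?_)
    (tendsto_pi_nhds.2 fun p => tendsto_starProjection_ker (A p.1) p.2)
  simp only [birkhoffAverage, birkhoffSum, _root_.id]
  exact (continuous_finsetSum _ fun i _ => hiter i).const_smul _

end MeasurableProjection

/-! ### Haar measure on `O(d)` and on stabilizers of subspaces. -/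

section Haar

variable {d : ℕ}

/-- The action of `O(d)` on Euclidean space. -/
def act (Q : OGroup d) : EuclideanSpace ℝ (Fin d) →L[ℝ] EuclideanSpace ℝ (Fin d) :=
  Matrix.toEuclideanCLM (n := Fin d) (𝕜 := ℝ) Q.val

/-- A right translate is again a left Haar probability measure, so uniqueness applies. -/
theorem isMulRightInvariant_of_isProbabilityMeasure {G : Type*} [Group G] [TopologicalSpace G]
    [IsTopologicalGroup G] [CompactSpace G] [MeasurableSpace G] [BorelSpace G] (μ : Measure G)
    [μ.IsHaarMeasure] [IsProbabilityMeasure μ] : μ.IsMulRightInvariant where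
  map_mul_right_eq_self g := by
    have : IsProbabilityMeasure (μ.map (· * g)) :=
      Measure.isProbabilityMeasure_map (measurable_mul_const g).aemeasurable
    exact Measure.isHaarMeasure_eq_of_isProbabilityMeasure _ _

theorem act_mul (Q R : OGroup d) (x : EuclideanSpace ℝ (Fin d)) :
    act (Q * R) x = act Q (act R x) := by
  simp [act]

theorem act_one (x : EuclideanSpace ℝ (Fin d)) : act (1 : OGroup d) x = x := by
  simp [act]

theorem act_inv_act (Q : OGroup d) (x : EuclideanSpace ℝ (Fin d)) : act Q⁻¹ (act Q x) = x := by
  rw [← act_mul, inv_mul_cancel, act_one]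

theorem act_act_inv (Q : OGroup d) (x : EuclideanSpace ℝ (Fin d)) : act Q (act Q⁻¹ x) = x := by
  rw [← act_mul, mul_inv_cancel, act_one]

theorem adjoint_act_act (Q : OGroup d) (x : EuclideanSpace ℝ (Fin d)) :
    ContinuousLinearMap.adjoint (act Q) (act Q x) = x := by
  have h : star (act Q) * act Q = 1 := by
    rw [act, ← map_star, ← map_mul, (Unitary.mem_iff.1 Q.2).1, map_one]
  exact congrArg (fun f : EuclideanSpace ℝ (Fin d) →L[ℝ] EuclideanSpace ℝ (Fin d) => f x) h

theorem norm_act (Q : OGroup d) (x : EuclideanSpace ℝ (Fin d)) : ‖act Q x‖ = ‖x‖ := by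
  rw [← sq_eq_sq₀ (norm_nonneg _) (norm_nonneg _), ← real_inner_self_eq_norm_sq,
    ← ContinuousLinearMap.adjoint_inner_left, adjoint_act_act, real_inner_self_eq_norm_sq]

theorem exists_act_eq (f : EuclideanSpace ℝ (Fin d) ≃ₗᵢ[ℝ] EuclideanSpace ℝ (Fin d)) :
    ∃ Q : OGroup d, ∀ x, act Q x = f x := by
  set φ := Matrix.toEuclideanCLM (n := Fin d) (𝕜 := ℝ)
  set F : EuclideanSpace ℝ (Fin d) →L[ℝ] EuclideanSpace ℝ (Fin d) :=
    f.toLinearIsometry.toContinuousLinearMap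
  have h1 : star F * F = 1 := by
    ext1 x
    refine ext_inner_right ℝ fun y => ?_
    change inner ℝ (ContinuousLinearMap.adjoint F (F x)) y = inner ℝ x y
    rw [ContinuousLinearMap.adjoint_inner_left]
    exact f.inner_map_map x y
  have h2 : star (φ.symm F) * φ.symm F = 1 := by
    refine EquivLike.injective φ ?_
    rw [map_mul, map_star, φ.apply_symm_apply, h1, map_one]
  refine ⟨⟨φ.symm F, Unitary.mem_iff.2 ⟨h2, ?_⟩⟩, fun x => ?_⟩
  · exact mul_eq_one_comm.1 h2
  · change φ (φ.symm F) x = f x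
    rw [φ.apply_symm_apply]
    rfl

theorem continuous_toEuclideanCLM :
    Continuous (Matrix.toEuclideanCLM (n := Fin d) (𝕜 := ℝ)) :=
  LinearMap.continuous_of_finiteDimensional
    ((Matrix.toEuclideanCLM (n := Fin d) (𝕜 := ℝ)).toAlgEquiv.toLinearMap)

theorem continuous_act : Continuous (act : OGroup d → _) :=
  continuous_toEuclideanCLM.comp continuous_subtype_val

instance secondCountableTopology_OGroup : SecondCountableTopology (OGroup d) := by
  have : SecondCountableTopology (Matrix (Fin d) (Fin d) ℝ) :=
    inferInstanceAs (SecondCountableTopology (Fin d → Fin d → ℝ))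
  exact TopologicalSpace.Subtype.secondCountableTopology _

instance isProbabilityMeasure_uniformO : IsProbabilityMeasure (uniformO d) :=
  ⟨Measure.haarMeasure_self (K₀ := (⊤ : TopologicalSpace.PositiveCompacts (OGroup d)))⟩

instance isHaarMeasure_uniformO : (uniformO d).IsHaarMeasure :=
  inferInstanceAs (Measure.haarMeasure _).IsHaarMeasure

instance isMulRightInvariant_uniformO : (uniformO d).IsMulRightInvariant :=
  isMulRightInvariant_of_isProbabilityMeasure _

/-- The orthogonal transformations that preserve the subspace `L`. -/
def stabilizer (L : Submodule ℝ (EuclideanSpace ℝ (Fin d))) : Subgroup (OGroup d) where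
  carrier := {Q | (∀ x ∈ L, act Q x ∈ L) ∧ ∀ x ∈ L, act Q⁻¹ x ∈ L}
  mul_mem' := by
    rintro Q R ⟨hQ, hQ'⟩ ⟨hR, hR'⟩
    refine ⟨fun x hx => ?_, fun x hx => ?_⟩
    · rw [act_mul]
      exact hQ _ (hR _ hx)
    · rw [mul_inv_rev, act_mul]
      exact hR' _ (hQ' _ hx)
  one_mem' := ⟨fun x hx => by rwa [act_one], fun x hx => by rwa [inv_one, act_one]⟩
  inv_mem' := fun ⟨h, h'⟩ => ⟨h', by simpa using h⟩

variable {L : Submodule ℝ (EuclideanSpace ℝ (Fin d))}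

theorem act_mem_iff (R : stabilizer L) {x : EuclideanSpace ℝ (Fin d)} :
    act (R : OGroup d) x ∈ L ↔ x ∈ L :=
  ⟨fun h => by simpa [act_inv_act] using R.2.2 _ h, fun h => R.2.1 _ h⟩

theorem isClosed_stabilizer (L : Submodule ℝ (EuclideanSpace ℝ (Fin d))) :
    IsClosed (stabilizer L : Set (OGroup d)) := by
  have hL : IsClosed (L : Set (EuclideanSpace ℝ (Fin d))) := L.closed_of_finiteDimensional
  have h : (stabilizer L : Set (OGroup d))
      = (⋂ x ∈ L, {Q | act Q x ∈ L}) ∩ ⋂ x ∈ L, {Q | act Q⁻¹ x ∈ L} := by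
    ext Q
    simp only [Set.mem_inter_iff, Set.mem_iInter]
    rfl
  rw [h]
  refine (isClosed_biInter fun x _ => ?_).inter (isClosed_biInter fun x _ => ?_)
  · exact hL.preimage (continuous_act.clm_apply continuous_const)
  · exact hL.preimage ((continuous_act.comp continuous_inv).clm_apply continuous_const)

instance compactSpace_stabilizer : CompactSpace (stabilizer L) :=
  isCompact_iff_compactSpace.1 (isClosed_stabilizer L).isCompact

/-- The normalized Haar measure of the stabilizer of a subspace. -/
def stabMeasure (L : Submodule ℝ (EuclideanSpace ℝ (Fin d))) : Measure (stabilizer L) :=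
  Measure.haarMeasure ⊤

instance isProbabilityMeasure_stabMeasure : IsProbabilityMeasure (stabMeasure L) :=
  ⟨Measure.haarMeasure_self (K₀ := (⊤ : TopologicalSpace.PositiveCompacts (stabilizer L)))⟩

instance isHaarMeasure_stabMeasure : (stabMeasure L).IsHaarMeasure :=
  inferInstanceAs (Measure.haarMeasure _).IsHaarMeasure

instance isMulRightInvariant_stabMeasure : (stabMeasure L).IsMulRightInvariant :=
  isMulRightInvariant_of_isProbabilityMeasure _

theorem IsConicBorel.smul_mem_iff {E : Type*} [NormedAddCommGroup E] [InnerProductSpace ℝ E]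
    [MeasurableSpace E] {A : Set E} (hA : IsConicBorel A) {c : ℝ} (hc : 0 < c) {x : E} :
    c • x ∈ A ↔ x ∈ A := by
  constructor
  · intro h
    rw [← hA.2 c hc] at h
    obtain ⟨y, hy, hxy⟩ := h
    rwa [← smul_right_injective E hc.ne' hxy]
  · intro h
    rw [← hA.2 c hc]
    exact ⟨x, h, rfl⟩

/-- The stabilizer of `L` acts transitively on the rays of `L`. -/
theorem exists_stabilizer_smul_act {x y : EuclideanSpace ℝ (Fin d)} (hx : x ∈ L) (hy : y ∈ L)
    (hx0 : x ≠ 0) (hy0 : y ≠ 0) :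
    ∃ S : stabilizer L, ∃ c : ℝ, 0 < c ∧ y = c • act (S : OGroup d) x := by
  have hc : 0 < ‖y‖ / ‖x‖ := div_pos (norm_pos_iff.2 hy0) (norm_pos_iff.2 hx0)
  set c := ‖y‖ / ‖x‖ with hcdef
  have hnorm : ‖c • x‖ = ‖y‖ := by
    rw [norm_smul, Real.norm_of_nonneg hc.le, hcdef, div_mul_cancel₀ _ (norm_ne_zero_iff.2 hx0)]
  set v := c • x - y with hv
  have hvL : v ∈ L := L.sub_mem (L.smul_mem c hx) hy
  -- The reflection exchanging `c • x` and `y` preserves `L`, because its normal vector `c • x - y`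
  -- lies in `L`.
  set f := (Submodule.span ℝ {v})ᗮ.reflection with hf
  have hfL : ∀ z ∈ L, f z ∈ L := by
    intro z hz
    rw [hf, Submodule.reflection_orthogonal_apply, Submodule.reflection_singleton_apply, neg_sub]
    exact L.sub_mem hz (L.smul_of_tower_mem 2 (L.smul_mem _ hvL))
  obtain ⟨S, hS⟩ := exists_act_eq f
  have hSinv : ∀ z, act S⁻¹ z = f z := by
    intro z
    have : act S (f z) = z := by rw [hS, hf, Submodule.reflection_reflection]
    conv_lhs => rw [← this]
    rw [act_inv_act]
  refine ⟨⟨S, fun z hz => ?_, fun z hz => ?_⟩, c, hc, ?_⟩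
  · rw [hS]; exact hfL z hz
  · rw [hSinv]; exact hfL z hz
  · change y = c • act S x
    rw [hS, ← map_smul]
    exact (Submodule.reflection_sub hnorm).symm

theorem stdGaussian_stabilizer_invariant (R : stabilizer L)
    {A : Set (EuclideanSpace ℝ (Fin d))} (hA : MeasurableSet A) :
    stdGaussian L {x : L | act (R : OGroup d) x ∈ A}
      = stdGaussian L {x : L | (x : EuclideanSpace ℝ (Fin d)) ∈ A} := by
  let f₀ : L →ₗᵢ[ℝ] L :=
    { toFun := fun x => ⟨act (R : OGroup d) x, R.2.1 _ x.2⟩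
      map_add' := fun x y => Subtype.ext (map_add _ _ _)
      map_smul' := fun c x => Subtype.ext (map_smul _ _ _)
      norm_map' := fun x => norm_act _ _ }
  let f : L ≃ₗᵢ[ℝ] L := f₀.toLinearIsometryEquiv rfl
  conv_rhs => rw [← stdGaussian_map f, Measure.map_apply f.continuous.measurable
    (measurableSet_trace hA L)]
  rfl

/-- The random image of a nonzero vector of `L` under the stabilizer of `L` has the directional
distribution of a Gaussian vector of `L`. -/
theorem stabMeasure_act_mem {A : Set (EuclideanSpace ℝ (Fin d))} (hA : IsConicBorel A)
    {y : EuclideanSpace ℝ (Fin d)} (hy : y ∈ L) (hy0 : y ≠ 0) :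
    stabMeasure L {R | act (R : OGroup d) y ∈ A}
      = stdGaussian L {x : L | (x : EuclideanSpace ℝ (Fin d)) ∈ A} := by
  -- By transitivity on rays and right invariance, the probability does not depend on the nonzero
  -- starting vector.
  have hconst : ∀ x ∈ L, x ≠ 0 → stabMeasure L {R | act (R : OGroup d) x ∈ A}
      = stabMeasure L {R | act (R : OGroup d) y ∈ A} := by
    intro x hx hx0
    obtain ⟨S, c, hc, rfl⟩ := exists_stabilizer_smul_act hx hy hx0 hy0
    rw [← measure_preimage_mul_right (stabMeasure L) S]
    congr 1
    ext R
    change act ((R * S : stabilizer L) : OGroup d) x ∈ A ↔ act (R : OGroup d) (c • _) ∈ A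
    rw [map_smul, hA.smul_mem_iff hc, Subgroup.coe_mul, act_mul]
  have hS : MeasurableSet {p : stabilizer L × L | act (p.1 : OGroup d) p.2 ∈ A} := by
    have : Continuous fun p : stabilizer L × L => act (p.1 : OGroup d) p.2 :=
      (continuous_act.comp (continuous_subtype_val.comp continuous_fst)).clm_apply
        (continuous_subtype_val.comp continuous_snd)
    exact this.measurable hA.1
  -- Fubini for a random `R` applied to an independent Gaussian `x` in `L`: fixing `R` gives the
  -- Gaussian measure by rotation invariance, fixing `x ≠ 0` gives the constant above.
  have h1 := Measure.prod_apply (μ := stabMeasure L) (ν := stdGaussian L) hS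
  have h2 := Measure.prod_apply_symm (μ := stabMeasure L) (ν := stdGaussian L) hS
  have hbot : (⊥ : Submodule ℝ L) ≠ ⊤ := by
    intro h
    have : (⟨y, hy⟩ : L) ∈ (⊥ : Submodule ℝ L) := h ▸ Submodule.mem_top
    exact hy0 (congrArg Subtype.val ((Submodule.mem_bot ℝ).1 this))
  have hae : ∀ᵐ x ∂stdGaussian L, x ≠ 0 := by
    filter_upwards [measure_eq_zero_iff_ae_notMem.1 (stdGaussian_submodule_eq_zero hbot)] with x hx
    exact fun h => hx (by simp [h])
  have e1 : ∫⁻ R, stdGaussian L (Prod.mk R ⁻¹'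
      {p : stabilizer L × L | act (p.1 : OGroup d) p.2 ∈ A})
      ∂stabMeasure L = stdGaussian L {x : L | (x : EuclideanSpace ℝ (Fin d)) ∈ A} := by
    refine (lintegral_congr fun R => stdGaussian_stabilizer_invariant R hA.1).trans ?_
    rw [lintegral_const, measure_univ, mul_one]
  have e2 : ∫⁻ x, stabMeasure L ((fun R => (R, x)) ⁻¹'
      {p : stabilizer L × L | act (p.1 : OGroup d) p.2 ∈ A}) ∂stdGaussian L
      = stabMeasure L {R | act (R : OGroup d) y ∈ A} := by
    rw [lintegral_congr_ae (g := fun _ => stabMeasure L {R | act (R : OGroup d) y ∈ A})]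
    · simp
    · filter_upwards [hae] with x hx
      exact hconst x x.2 fun h => hx (Subtype.ext h)
  rw [← e1, ← e2, ← h1, ← h2]

end Haar

/-! ### Randomly moved subspaces and averaging over stabilizers. -/

section RandomIntersection

variable {d : ℕ}

/-- The inverse of the map `x ↦ T Q x`. -/
def pullback (T : GL (Fin d) ℝ) (Q : OGroup d) :
    EuclideanSpace ℝ (Fin d) →L[ℝ] EuclideanSpace ℝ (Fin d) :=
  act Q⁻¹ ∘L Matrix.toEuclideanCLM (n := Fin d) (𝕜 := ℝ) T⁻¹.val

theorem pullback_mul_inv (T : GL (Fin d) ℝ) (Q R : OGroup d) (x : EuclideanSpace ℝ (Fin d)) :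
    pullback T (Q * R⁻¹) x = act R (pullback T Q x) := by
  simp [pullback, act_mul]

theorem continuous_pullback (T : GL (Fin d) ℝ) : Continuous (pullback T) :=
  (continuous_act.comp continuous_inv).clm_comp continuous_const

/-- The map `x ↦ T Q x` as an equivalence. -/
def moveEquiv (T : GL (Fin d) ℝ) (Q : OGroup d) :
    EuclideanSpace ℝ (Fin d) ≃L[ℝ] EuclideanSpace ℝ (Fin d) :=
  ContinuousLinearEquiv.equivOfInverse
    (Matrix.toEuclideanCLM (n := Fin d) (𝕜 := ℝ) T.val ∘L act Q) (pullback T Q)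
    (fun x => by
      have h : ∀ y, Matrix.toEuclideanCLM (n := Fin d) (𝕜 := ℝ) T⁻¹.val
          (Matrix.toEuclideanCLM (n := Fin d) (𝕜 := ℝ) T.val y) = y := fun y => by
        rw [← mul_apply_eq_comp, ← map_mul, Units.inv_mul, map_one]
        rfl
      simp only [pullback, ContinuousLinearMap.comp_apply]
      rw [h, act_inv_act])
    (fun x => by
      simp only [pullback, ContinuousLinearMap.comp_apply]
      rw [act_act_inv, ← mul_apply_eq_comp, ← map_mul, Units.mul_inv, map_one]
      rfl)

theorem moveEquiv_symm_apply (T : GL (Fin d) ℝ) (Q : OGroup d) (x : EuclideanSpace ℝ (Fin d)) :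
    (moveEquiv T Q).symm x = pullback T Q x := rfl

theorem move_eq_image (T : GL (Fin d) ℝ) (Q : OGroup d) (A : Set (EuclideanSpace ℝ (Fin d))) :
    move T Q A = moveEquiv T Q '' A := by
  have : ∀ x, Matrix.toEuclideanLin (T.val * Q.val) x = moveEquiv T Q x := fun x => by
    rw [← Matrix.coe_toEuclideanCLM_eq_toEuclideanLin, map_mul]
    rfl
  simp only [move, this]

theorem mem_move_iff {T : GL (Fin d) ℝ} {Q : OGroup d} {A : Set (EuclideanSpace ℝ (Fin d))}
    {x : EuclideanSpace ℝ (Fin d)} : x ∈ move T Q A ↔ pullback T Q x ∈ A := by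
  rw [move_eq_image, ← moveEquiv_symm_apply]
  exact (moveEquiv T Q).toEquiv.image_eq_preimage_symm A ▸ Iff.rfl

variable {ι : Type*} [Fintype ι]

/-- The intersection of the subspaces `T i Q i L i`. -/
def movedInter (T : ι → GL (Fin d) ℝ) (L : ι → Submodule ℝ (EuclideanSpace ℝ (Fin d)))
    (Q : ι → OGroup d) : Submodule ℝ (EuclideanSpace ℝ (Fin d)) :=
  ⨅ i, (L i).comap (pullback (T i) (Q i) : _ →ₗ[ℝ] _)

variable (T : ι → GL (Fin d) ℝ) (L : ι → Submodule ℝ (EuclideanSpace ℝ (Fin d)))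

theorem mem_movedInter {T : ι → GL (Fin d) ℝ} {L : ι → Submodule ℝ (EuclideanSpace ℝ (Fin d))}
    {Q : ι → OGroup d} {x : EuclideanSpace ℝ (Fin d)} :
    x ∈ movedInter T L Q ↔ ∀ i, pullback (T i) (Q i) x ∈ L i := by
  simp [movedInter]

theorem iInf_map_moveEquiv (Q : ι → OGroup d) :
    ⨅ i, (L i).map (moveEquiv (T i) (Q i) : _ →ₗ[ℝ] EuclideanSpace ℝ (Fin d))
      = movedInter T L Q := by
  refine iInf_congr fun i => ?_
  ext x
  exact Submodule.mem_map_equiv (e := (moveEquiv (T i) (Q i)).toLinearEquiv) (L i)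

/-- This is the symmetry behind the averaging: the intersection stays fixed while, by
`pullback_mul_inv`, pullbacks of its vectors are rotated by the `R i`. -/
theorem movedInter_mul_inv (Q : ι → OGroup d) (R : ∀ i, stabilizer (L i)) :
    movedInter T L (Q * fun i => ((R i : OGroup d))⁻¹) = movedInter T L Q := by
  ext x
  simp only [mem_movedInter, Pi.mul_apply, pullback_mul_inv, act_mem_iff]

theorem measurable_starProjection_movedInter :
    Measurable fun p : (ι → OGroup d) × EuclideanSpace ℝ (Fin d) =>
      (movedInter T L p.1).starProjection p.2 := by
  -- The intersection is the kernel of a continuous family of maps: the components of the pullbacks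
  -- orthogonal to the `L i` must all vanish.
  let A : (ι → OGroup d) → EuclideanSpace ℝ (Fin d) →L[ℝ]
      PiLp 2 fun _ : ι => EuclideanSpace ℝ (Fin d) := fun Q =>
    (PiLp.continuousLinearEquiv 2 ℝ fun _ : ι => EuclideanSpace ℝ (Fin d)).symm ∘L
      ContinuousLinearMap.pi fun i => (L i)ᗮ.starProjection ∘L pullback (T i) (Q i)
  have hA : Continuous A := by
    rw [continuous_clm_apply]
    intro x
    refine (PiLp.continuous_toLp 2 _).comp (continuous_pi fun i => ?_)
    exact (L i)ᗮ.starProjection.continuous.comp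
      (((continuous_pullback (T i)).comp (continuous_apply i)).clm_apply continuous_const)
  have hker : ∀ Q, movedInter T L Q = (A Q).ker := by
    intro Q
    ext x
    rw [mem_movedInter]
    change _ ↔ WithLp.toLp 2 (fun i => (L i)ᗮ.starProjection (pullback (T i) (Q i) x)) = 0
    rw [WithLp.toLp_eq_zero, funext_iff]
    refine forall_congr' fun i => ?_
    rw [Pi.zero_apply, Submodule.starProjection_apply_eq_zero_iff, Submodule.orthogonal_orthogonal]
  have e : (fun p : (ι → OGroup d) × EuclideanSpace ℝ (Fin d) =>
      (movedInter T L p.1).starProjection p.2) = fun p => (A p.1).ker.starProjection p.2 :=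
    funext fun p => starProjection_congr (hker p.1) p.2
  rw [e]
  exact measurable_starProjection_ker hA

/-- The law of a tuple of independent uniformly distributed orthogonal transformations. -/
abbrev uniformTuple (ι : Type*) [Fintype ι] (d : ℕ) : Measure (ι → OGroup d) :=
  Measure.pi fun _ => uniformO d

theorem measurable_pullback_starProjection (i : ι) :
    Measurable fun p : (ι → OGroup d) × EuclideanSpace ℝ (Fin d) =>
      pullback (T i) (p.1 i) ((movedInter T L p.1).starProjection p.2) := by
  have h : Continuous fun q : OGroup d × EuclideanSpace ℝ (Fin d) => pullback (T i) q.1 q.2 :=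
    ((continuous_pullback (T i)).comp continuous_fst).clm_apply continuous_snd
  have hi : Measurable fun p : (ι → OGroup d) × EuclideanSpace ℝ (Fin d) => p.1 i :=
    (measurable_pi_apply i).comp measurable_fst
  have hm := h.measurable
  have := hm.fun_comp (hi.prodMk (measurable_starProjection_movedInter T L))
  exact this

theorem measurableSet_pullback_starProjection {A : ι → Set (EuclideanSpace ℝ (Fin d))}
    (hA : ∀ i, MeasurableSet (A i)) :
    MeasurableSet {p : (ι → OGroup d) × EuclideanSpace ℝ (Fin d) |
      ∀ i, pullback (T i) (p.1 i) ((movedInter T L p.1).starProjection p.2) ∈ A i} := by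
  rw [Set.ofPred_forall]
  exact MeasurableSet.iInter fun i => measurable_pullback_starProjection T L i (hA i)

theorem measurableSet_starProjection_ne_zero :
    MeasurableSet {p : (ι → OGroup d) × EuclideanSpace ℝ (Fin d) |
      (movedInter T L p.1).starProjection p.2 ≠ 0} :=
  (measurable_starProjection_movedInter T L (measurableSet_singleton 0)).compl

/-- Averaging over the stabilizers of the `L i`: the pullbacks of a nonzero vector of the random
intersection have independent Gaussian directions in the `L i`. -/
theorem measure_prod_pullback_mem {A : ι → Set (EuclideanSpace ℝ (Fin d))}
    (hA : ∀ i, IsConicBorel (A i)) :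
    (uniformTuple ι d).prod (stdGaussian (EuclideanSpace ℝ (Fin d)))
        ({p | (movedInter T L p.1).starProjection p.2 ≠ 0} ∩
          {p | ∀ i, pullback (T i) (p.1 i) ((movedInter T L p.1).starProjection p.2) ∈ A i})
      = (∏ i, stdGaussian (L i) {x : L i | (x : EuclideanSpace ℝ (Fin d)) ∈ A i}) *
        (uniformTuple ι d).prod (stdGaussian (EuclideanSpace ℝ (Fin d)))
          {p | (movedInter T L p.1).starProjection p.2 ≠ 0} := by
  set π := (uniformTuple ι d).prod (stdGaussian (EuclideanSpace ℝ (Fin d))) with hπ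
  set ν := Measure.pi fun i => stabMeasure (L i) with hν
  set S₀ := {p : (ι → OGroup d) × EuclideanSpace ℝ (Fin d) |
    (movedInter T L p.1).starProjection p.2 ≠ 0} with hS₀
  set S := S₀ ∩ {p : (ι → OGroup d) × EuclideanSpace ℝ (Fin d) |
    ∀ i, pullback (T i) (p.1 i) ((movedInter T L p.1).starProjection p.2) ∈ A i} with hS
  have hS₀m : MeasurableSet S₀ := measurableSet_starProjection_ne_zero T L
  have hSm : MeasurableSet S :=
    hS₀m.inter (measurableSet_pullback_starProjection T L fun i => (hA i).1)
  let φ : (∀ i, stabilizer (L i)) → ι → OGroup d := fun R i => ((R i : OGroup d))⁻¹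
  have hφ : Measurable φ := measurable_pi_lambda _ fun i =>
    ((continuous_subtype_val (p := fun Q => Q ∈ stabilizer (L i))).inv.measurable).comp
      (measurable_pi_apply i)
  let Φ : (∀ i, stabilizer (L i)) × ((ι → OGroup d) × EuclideanSpace ℝ (Fin d)) →
      (ι → OGroup d) × EuclideanSpace ℝ (Fin d) := fun q => (q.2.1 * φ q.1, q.2.2)
  have hΦ : Measurable Φ := by
    refine Measurable.prodMk ?_ (by fun_prop)
    exact (measurable_fst.comp measurable_snd).mul (hφ.comp measurable_fst)
  have h1 := Measure.prod_apply (μ := ν) (ν := π) (hΦ hSm)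
  have h2 := Measure.prod_apply_symm (μ := ν) (ν := π) (hΦ hSm)
  -- For fixed `R`, the substitution is a right translation and preserves the measure.
  have hinv : ∀ R, π (Prod.mk R ⁻¹' (Φ ⁻¹' S)) = π S := by
    intro R
    have hmp : MeasurePreserving (fun p : (ι → OGroup d) × EuclideanSpace ℝ (Fin d) =>
        (p.1 * φ R, p.2)) π π :=
      (measurePreserving_mul_right (uniformTuple ι d) (φ R)).prod (MeasurePreserving.id _)
    exact hmp.measure_preimage hSm.nullMeasurableSet
  -- For fixed `Q` and `x`, the projected vector does not depend on `R`; the conditions on the `R i`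
  -- are independent, and each has Gaussian probability by `stabMeasure_act_mem`.
  have hcond : ∀ p, ν ((fun R => (R, p)) ⁻¹' (Φ ⁻¹' S))
      = S₀.indicator (fun _ => ∏ i, stdGaussian (L i)
          {x : L i | (x : EuclideanSpace ℝ (Fin d)) ∈ A i}) p := by
    rintro ⟨Q, x⟩
    have hV := fun R => movedInter_mul_inv T L Q R
    by_cases hx : (movedInter T L Q).starProjection x = 0
    · rw [Set.indicator_of_notMem (by simpa [hS₀] using hx)]
      convert measure_empty (μ := ν)
      ext R
      refine iff_of_false (fun h => h.1 ?_) (Set.notMem_empty R)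
      change (movedInter T L (Q * φ R)).starProjection x = 0
      rw [hV R]
      exact hx
    · rw [Set.indicator_of_mem (by simpa [hS₀] using hx)]
      set v := (movedInter T L Q).starProjection x with hv
      have hvV : ∀ i, pullback (T i) (Q i) v ∈ L i :=
        mem_movedInter.1 (Submodule.starProjection_apply_mem _ _)
      have hset : (fun R => (R, (Q, x))) ⁻¹' (Φ ⁻¹' S)
          = Set.univ.pi fun i => {R : stabilizer (L i) |
              act (R : OGroup d) (pullback (T i) (Q i) v) ∈ A i} := by
        ext R
        have e : (movedInter T L (Q * φ R)).starProjection x = v := by rw [hV R]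
        have e' : ∀ i, pullback (T i) ((Q * φ R) i) v
            = act (R i : OGroup d) (pullback (T i) (Q i) v) := fun i =>
          pullback_mul_inv _ _ _ _
        change ((movedInter T L (Q * φ R)).starProjection x ≠ 0 ∧
          ∀ i, pullback (T i) ((Q * φ R) i)
            ((movedInter T L (Q * φ R)).starProjection x) ∈ A i) ↔ _
        simp only [e, e']
        simp [hx]
      rw [hset, hν, Measure.pi_pi]
      refine Finset.prod_congr rfl fun i _ => stabMeasure_act_mem (hA i) (hvV i) fun h0 => hx ?_
      rw [← moveEquiv_symm_apply] at h0
      exact (moveEquiv (T i) (Q i)).symm.map_eq_zero_iff.1 h0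
  rw [lintegral_congr hinv, lintegral_const, measure_univ, mul_one] at h1
  rw [lintegral_congr hcond, lintegral_indicator_const hS₀m] at h2
  rw [← h1, h2]

end RandomIntersection

/-! ### Almost sure general position. -/

section Transversality

variable {d : ℕ} {ι : Type*} [Fintype ι]

theorem isConicBorel_submodule (K : Submodule ℝ (EuclideanSpace ℝ (Fin d))) :
    IsConicBorel (K : Set (EuclideanSpace ℝ (Fin d))) := by
  refine ⟨K.closed_of_finiteDimensional.measurableSet, fun c hc => Set.Subset.antisymm ?_ ?_⟩
  · rintro _ ⟨x, hx, rfl⟩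
    exact K.smul_mem c hx
  · exact fun x hx => ⟨c⁻¹ • x, K.smul_mem _ hx, smul_inv_smul₀ hc.ne' x⟩

theorem isConicBorel_univ {E : Type*} [NormedAddCommGroup E] [InnerProductSpace ℝ E]
    [MeasurableSpace E] : IsConicBorel (Set.univ : Set E) :=
  ⟨MeasurableSet.univ, fun c hc => Set.eq_univ_of_forall fun x => ⟨c⁻¹ • x, trivial, by
    simp [smul_smul, hc.ne']⟩⟩

theorem IsConicBorel.inter {E : Type*} [NormedAddCommGroup E] [InnerProductSpace ℝ E]
    [MeasurableSpace E] {A B : Set E} (hA : IsConicBorel A) (hB : IsConicBorel B) :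
    IsConicBorel (A ∩ B) :=
  ⟨hA.1.inter hB.1, fun c hc => by
    rw [Set.image_inter (smul_right_injective E hc.ne'), hA.2 c hc, hB.2 c hc]⟩

theorem IsPolyhedralCone.isConicBorel {E : Type*} [NormedAddCommGroup E] [InnerProductSpace ℝ E]
    [MeasurableSpace E] [BorelSpace E] {C : Set E} (hC : IsPolyhedralCone C) : IsConicBorel C := by
  obtain ⟨A, rfl⟩ := hC
  constructor
  · have : IsClosed {x : E | ∀ a ∈ A, inner ℝ x a ≤ 0} := by
      simp only [Set.ofPred_forall]
      exact isClosed_biInter fun a _ => isClosed_le (by fun_prop) continuous_const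
    exact this.measurableSet
  · intro c hc
    refine Set.Subset.antisymm ?_ fun x hx => ⟨c⁻¹ • x, fun a ha => ?_, smul_inv_smul₀ hc.ne' x⟩
    · rintro _ ⟨x, hx, rfl⟩ a ha
      rw [inner_smul_left]
      exact mul_nonpos_of_nonneg_of_nonpos hc.le (hx a ha)
    · rw [inner_smul_left]
      exact mul_nonpos_of_nonneg_of_nonpos (inv_pos.2 hc).le (hx a ha)

theorem finrank_comap_pullback (T : GL (Fin d) ℝ) (Q : OGroup d)
    (K : Submodule ℝ (EuclideanSpace ℝ (Fin d))) :
    Module.finrank ℝ (K.comap (pullback T Q).toLinearMap) = Module.finrank ℝ K :=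
  LinearEquiv.finrank_eq (Submodule.comap_equiv_self_of_inj_of_le
    (f := (pullback T Q : EuclideanSpace ℝ (Fin d) →ₗ[ℝ] EuclideanSpace ℝ (Fin d)))
    (moveEquiv T Q).symm.injective
    (fun x _ => ⟨moveEquiv T Q x, (moveEquiv T Q).symm_apply_apply x⟩))

/-- Independent random rotations of subspaces are almost surely in general position. -/
theorem ae_finrank_movedInter_codim (T : ι → GL (Fin d) ℝ) (c : ℕ) :
    ∀ L : ι → Submodule ℝ (EuclideanSpace ℝ (Fin d)), ∑ i, (d - Module.finrank ℝ (L i)) = c →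
      ∀ᵐ Q ∂uniformTuple ι d, Module.finrank ℝ (movedInter T L Q) = d - c := by
  classical
  have hle : ∀ K : Submodule ℝ (EuclideanSpace ℝ (Fin d)), Module.finrank ℝ K ≤ d := fun K => by
    simpa using K.finrank_le
  induction c with
  | zero =>
    intro L hL
    refine Filter.Eventually.of_forall fun Q => ?_
    have htop : ∀ i, L i = ⊤ := fun i => by
      have := (Finset.sum_eq_zero_iff.1 hL) i (Finset.mem_univ i)
      exact Submodule.eq_top_of_finrank_eq (by simpa using (hle (L i)).antisymm (by omega))
    have : movedInter T L Q = ⊤ := by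
      simp [movedInter, htop]
    rw [this]
    simp
  | succ c ih =>
    intro L hL
    obtain ⟨i, hi⟩ : ∃ i, L i ≠ ⊤ := by
      by_contra! h
      rw [Finset.sum_eq_zero fun j _ => by rw [h j, finrank_top, finrank_euclideanSpace_fin,
        Nat.sub_self]] at hL
      omega
    obtain ⟨v, hv, hv0⟩ := Submodule.exists_mem_ne_zero_of_ne_bot
      (mt Submodule.orthogonal_eq_bot_iff.1 hi)
    -- Enlarging one factor by a dimension lowers the total codimension to `c`; `L i` is recovered
    -- as the hyperplane `v^⊥` in `K`.
    set K := L i ⊔ Submodule.span ℝ {v} with hK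
    have hvK : v ∈ K := Submodule.mem_sup_right (Submodule.mem_span_singleton_self v)
    have hKv : L i = K ⊓ (Submodule.span ℝ {v})ᗮ := by
      apply le_antisymm
      · refine le_inf le_sup_left fun x hx => ?_
        rw [Submodule.mem_orthogonal_singleton_iff_inner_left]
        exact (Submodule.mem_orthogonal _ _).1 hv x hx
      · rintro x ⟨hxK, hxv⟩
        obtain ⟨y, hy, z, hz, rfl⟩ := Submodule.mem_sup.1 hxK
        obtain ⟨a, rfl⟩ := Submodule.mem_span_singleton.1 hz
        rw [SetLike.mem_coe, Submodule.mem_orthogonal_singleton_iff_inner_left, inner_add_left,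
          (Submodule.mem_orthogonal _ _).1 hv y hy, inner_smul_left, zero_add, mul_eq_zero,
          inner_self_eq_zero, or_iff_left hv0] at hxv
        have ha : a = 0 := by simpa using hxv
        simpa [ha] using hy
    have hdimK : Module.finrank ℝ K = Module.finrank ℝ (L i) + 1 := by
      have h1 := Submodule.finrank_sup_add_finrank_inf_eq (L i) (Submodule.span ℝ {v})
      have h2 : L i ⊓ Submodule.span ℝ {v} = ⊥ := by
        rw [eq_bot_iff]
        rintro x ⟨hx, hxv⟩
        obtain ⟨a, rfl⟩ := Submodule.mem_span_singleton.1 hxv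
        have h3 := (Submodule.mem_orthogonal _ _).1 hv _ hx
        rw [inner_smul_left, mul_eq_zero, inner_self_eq_zero, or_iff_left hv0] at h3
        have ha : a = 0 := by simpa using h3
        simp [ha]
      rw [h2, finrank_bot, finrank_span_singleton hv0] at h1
      exact h1
    set L' := Function.update L i K with hL'
    have hL'i : L' i = K := Function.update_self _ _ _
    have hL'j : ∀ j, j ≠ i → L' j = L j := fun j hj => Function.update_of_ne hj _ _
    have hsum : ∑ j, (d - Module.finrank ℝ (L' j)) = c := by
      rw [← Finset.add_sum_erase _ _ (Finset.mem_univ i)] at hL ⊢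
      rw [Finset.sum_congr rfl fun j hj => by rw [hL'j j (Finset.ne_of_mem_erase hj)], hL'i, hdimK]
      have := hle K
      omega
    have hV : ∀ Q, movedInter T L Q = movedInter T L' Q ⊓
        (Submodule.span ℝ {v})ᗮ.comap (pullback (T i) (Q i)).toLinearMap := by
      intro Q
      ext x
      rw [Submodule.mem_inf, mem_movedInter, mem_movedInter]
      constructor
      · intro h
        have hi' := h i
        rw [hKv] at hi'
        refine ⟨fun j => ?_, hi'.2⟩
        by_cases hj : j = i
        · subst hj
          rw [hL'i]
          exact hi'.1
        · rw [hL'j j hj]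
          exact h j
      · rintro ⟨h, hx⟩ j
        by_cases hj : j = i
        · subst hj
          rw [hKv]
          refine ⟨?_, hx⟩
          have := h j
          rwa [hL'i] at this
        · have := h j
          rwa [hL'j j hj] at this
    let A : ι → Set (EuclideanSpace ℝ (Fin d)) := fun j =>
      if j = i then ((Submodule.span ℝ {v})ᗮ : Submodule ℝ (EuclideanSpace ℝ (Fin d))) else Set.univ
    have hA : ∀ j, IsConicBorel (A j) := fun j => by
      by_cases hj : j = i
      · simpa [A, hj] using isConicBorel_submodule (Submodule.span ℝ {v})ᗮ
      · simpa [A, hj] using isConicBorel_univ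
    have hzero : stdGaussian (L' i) {x : L' i | (x : EuclideanSpace ℝ (Fin d)) ∈ A i} = 0 := by
      have : stdGaussian (L' i)
          ((Submodule.span ℝ {v})ᗮ.comap (L' i).subtype : Set (L' i)) = 0 := by
        refine stdGaussian_submodule_eq_zero fun htop => hv0 ?_
        have hvv := Submodule.comap_subtype_eq_top.1 htop (hL'i ▸ hvK)
        rwa [Submodule.mem_orthogonal_singleton_iff_inner_left, inner_self_eq_zero] at hvv
      refine measure_mono_null (fun x hx => ?_) this
      simpa [A] using hx
    -- A hyperplane of `K` is Gaussian null, so almost surely no nonzero projected vector pulls back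
    -- into `v^⊥`.
    have hnull := measure_prod_pullback_mem T L' hA
    rw [Finset.prod_eq_zero (Finset.mem_univ i) hzero, zero_mul] at hnull
    have hae := Measure.ae_ae_of_ae_prod (measure_eq_zero_iff_ae_notMem.1 hnull)
    filter_upwards [ih L' hsum, hae] with Q hQ hQae
    -- If the larger intersection is already zero, then `d - c = 0`, and the truncated `d - (c + 1)`
    -- is zero as well.
    by_cases hbot : movedInter T L' Q = ⊥
    · rw [hbot, finrank_bot] at hQ
      rw [hV, hbot, bot_inf_eq, finrank_bot]
      omega
    · obtain ⟨x, hx, hx0⟩ := (hQae.and (ae_starProjection_ne_zero hbot)).exists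
      have hlt : movedInter T L Q < movedInter T L' Q := by
        rw [hV]
        refine lt_of_le_of_ne inf_le_left fun heq => hx ⟨hx0, fun j => ?_⟩
        by_cases hj : j = i
        · subst hj
          simp only [A, if_true]
          exact (inf_eq_left.1 heq) (Submodule.starProjection_apply_mem _ x)
        · simp [A, hj]
      -- The dimension drops strictly, and a hyperplane can lower it by at most one.
      have h1 := Submodule.finrank_lt_finrank_of_lt hlt
      have h2 := Submodule.finrank_sup_add_finrank_inf_eq (movedInter T L' Q)
        ((Submodule.span ℝ {v})ᗮ.comap (pullback (T i) (Q i)).toLinearMap)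
      rw [← hV, finrank_comap_pullback] at h2
      have h3 := (Submodule.span ℝ {v}).finrank_add_finrank_orthogonal
      rw [finrank_span_singleton hv0, finrank_euclideanSpace_fin] at h3
      have h4 := hle (movedInter T L' Q ⊔
        (Submodule.span ℝ {v})ᗮ.comap (pullback (T i) (Q i)).toLinearMap)
      omega

theorem ae_finrank_movedInter {n : ℕ} (T : Fin (n + 1) → GL (Fin d) ℝ)
    (L : Fin (n + 1) → Submodule ℝ (EuclideanSpace ℝ (Fin d))) :
    ∀ᵐ Q ∂uniformTuple (Fin (n + 1)) d,
      Module.finrank ℝ (movedInter T L Q) = ∑ i, Module.finrank ℝ (L i) - n * d := by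
  filter_upwards [ae_finrank_movedInter_codim T _ L rfl] with Q hQ
  have hsum : ∑ i, (d - Module.finrank ℝ (L i)) + ∑ i, Module.finrank ℝ (L i) = n * d + d := by
    rw [← Finset.sum_add_distrib, Finset.sum_congr rfl fun i _ => Nat.sub_add_cancel
      (by simpa using (L i).finrank_le)]
    simp [add_mul]
  omega

end Transversality

/-! ### Expectation of a single Gaussian term. -/

section Expectation

variable {d n k : ℕ}

/-- The term becomes the measure of a section of one fixed measurable set, which yields
measurability in `Q` and allows Fubini. -/
theorem gaussOn_movedInter (T : Fin (n + 1) → GL (Fin d) ℝ)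
    (L : Fin (n + 1) → Submodule ℝ (EuclideanSpace ℝ (Fin d)))
    {A : Fin (n + 1) → Set (EuclideanSpace ℝ (Fin d))} (hA : ∀ i, MeasurableSet (A i))
    (Q : Fin (n + 1) → OGroup d) :
    gaussOn (movedInter T L Q) {x | ∀ i, pullback (T i) (Q i) x ∈ A i}
      = (stdGaussian (EuclideanSpace ℝ (Fin d)) (Prod.mk Q ⁻¹' {p |
          ∀ i, pullback (T i) (p.1 i) ((movedInter T L p.1).starProjection p.2) ∈ A i})).toReal := by
  rw [gaussOn, measureReal_def, stdGaussian_trace]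
  · rfl
  · rw [Set.ofPred_forall]
    exact MeasurableSet.iInter fun i => (pullback (T i) (Q i)).continuous.measurable (hA i)

theorem integrable_gaussOn_movedInter (T : Fin (n + 1) → GL (Fin d) ℝ)
    (L : Fin (n + 1) → Submodule ℝ (EuclideanSpace ℝ (Fin d)))
    {A : Fin (n + 1) → Set (EuclideanSpace ℝ (Fin d))} (hA : ∀ i, MeasurableSet (A i)) :
    Integrable (fun Q => gaussOn (movedInter T L Q) {x | ∀ i, pullback (T i) (Q i) x ∈ A i})
      (uniformTuple (Fin (n + 1)) d) := by
  simp_rw [gaussOn_movedInter T L hA]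
  refine integrable_toReal_of_lintegral_ne_top
    (measurable_measure_prodMk_left
      (measurableSet_pullback_starProjection T L hA)).aemeasurable ?_
  rw [← Measure.prod_apply (measurableSet_pullback_starProjection T L hA)]
  exact measure_ne_top _ _

theorem measure_prod_starProjection_ne_zero (hk : 0 < k) (T : Fin (n + 1) → GL (Fin d) ℝ)
    {L : Fin (n + 1) → Submodule ℝ (EuclideanSpace ℝ (Fin d))}
    (hL : ∑ i, Module.finrank ℝ (L i) = n * d + k) :
    (uniformTuple (Fin (n + 1)) d).prod (stdGaussian (EuclideanSpace ℝ (Fin d)))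
      {p | (movedInter T L p.1).starProjection p.2 ≠ 0} = 1 := by
  have hS := measurableSet_starProjection_ne_zero T L
  rw [Measure.prod_apply hS, lintegral_congr_ae (g := fun _ => 1)]
  · simp
  · filter_upwards [ae_finrank_movedInter T L] with Q hQ
    have hne : movedInter T L Q ≠ ⊥ := by
      intro h
      rw [h, finrank_bot] at hQ
      omega
    have hae := ae_starProjection_ne_zero hne
    have hm : MeasurableSet {x | (movedInter T L Q).starProjection x ≠ 0} :=
      (movedInter T L Q).starProjection.continuous.measurable
        (measurableSet_singleton 0).compl
    exact (mem_ae_iff_prob_eq_one hm).1 hae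

/-- Since `k > 0`, the projected Gaussian vector is almost surely nonzero, so the restriction in
`measure_prod_pullback_mem` can be dropped. -/
theorem integral_gaussOn_movedInter (hk : 0 < k) (T : Fin (n + 1) → GL (Fin d) ℝ)
    {L : Fin (n + 1) → Submodule ℝ (EuclideanSpace ℝ (Fin d))}
    (hL : ∑ i, Module.finrank ℝ (L i) = n * d + k)
    {A : Fin (n + 1) → Set (EuclideanSpace ℝ (Fin d))} (hA : ∀ i, IsConicBorel (A i)) :
    ∫ Q, gaussOn (movedInter T L Q) {x | ∀ i, pullback (T i) (Q i) x ∈ A i}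
      ∂uniformTuple (Fin (n + 1)) d = ∏ i, gaussOn (L i) (A i) := by
  have hm := measurableSet_pullback_starProjection T L fun i => (hA i).1
  simp_rw [gaussOn_movedInter T L fun i => (hA i).1]
  rw [integral_toReal (measurable_measure_prodMk_left hm).aemeasurable
    (Filter.Eventually.of_forall fun Q => measure_lt_top _ _), ← Measure.prod_apply hm]
  have hS := measurableSet_starProjection_ne_zero T L
  have hone := measure_prod_starProjection_ne_zero hk T hL
  have key := measure_prod_pullback_mem T L hA
  rw [hone, mul_one, Set.inter_comm, measure_inter_conull ((prob_compl_eq_zero_iff hS).2 hone)]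
    at key
  rw [key, ENNReal.toReal_prod]
  rfl

end Expectation

/-! ### Faces and polyhedral measures of a product of cones. -/

section Product

variable {d n : ℕ}

/-- The inclusion of the `i`-th factor into the Euclidean product. -/
def inclusion (d : ℕ) {n : ℕ} (i : Fin (n + 1)) : EuclideanSpace ℝ (Fin d) →ₗ[ℝ]
    PiLp 2 fun _ : Fin (n + 1) => EuclideanSpace ℝ (Fin d) :=
  (WithLp.linearEquiv 2 ℝ _).symm.toLinearMap ∘ₗ
    LinearMap.single ℝ (fun _ : Fin (n + 1) => EuclideanSpace ℝ (Fin d)) i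

theorem inclusion_apply (i j : Fin (n + 1)) (x : EuclideanSpace ℝ (Fin d)) :
    inclusion d i x j = if j = i then x else 0 := by
  change (Pi.single i x : Fin (n + 1) → EuclideanSpace ℝ (Fin d)) j = _
  rw [Pi.single_apply]

theorem inclusion_mem_prodSet {F : Fin (n + 1) → Set (EuclideanSpace ℝ (Fin d))}
    (h0 : ∀ i, 0 ∈ F i) {i : Fin (n + 1)} {x : EuclideanSpace ℝ (Fin d)} (hx : x ∈ F i) :
    inclusion d i x ∈ prodSet F := fun j => by
  rw [inclusion_apply]
  split_ifs with h
  · exact h ▸ hx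
  · exact h0 j

theorem inner_inclusion (i : Fin (n + 1)) (x : EuclideanSpace ℝ (Fin d))
    (z : PiLp 2 fun _ : Fin (n + 1) => EuclideanSpace ℝ (Fin d)) :
    inner ℝ (inclusion d i x) z = inner ℝ x (z i) := by
  rw [PiLp.inner_apply, Finset.sum_eq_single i]
  · rw [inclusion_apply, if_pos rfl]
  · intro j _ hj
    rw [inclusion_apply, if_neg hj, inner_zero_left]
  · simp

/-- The hypothesis `0 ∈ F i` lets each factor be embedded in the product by filling the other
coordinates with zero. -/
theorem span_prodSet {F : Fin (n + 1) → Set (EuclideanSpace ℝ (Fin d))} (h0 : ∀ i, 0 ∈ F i) :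
    Submodule.span ℝ (prodSet F) = piSubmodule fun i => Submodule.span ℝ (F i) := by
  apply le_antisymm
  · rw [Submodule.span_le]
    exact fun x hx i => Submodule.subset_span (hx i)
  · intro x hx
    have hsum : x = ∑ i, inclusion d i (x i) := by
      ext1 j
      rw [WithLp.ofLp_sum, Finset.sum_apply]
      simp [inclusion_apply]
    rw [hsum]
    refine Submodule.sum_mem _ fun i _ => ?_
    have hle : Submodule.span ℝ (F i)
        ≤ (Submodule.span ℝ (prodSet F)).comap (inclusion d i) := by
      rw [Submodule.span_le]
      exact fun y hy => Submodule.subset_span (inclusion_mem_prodSet h0 hy)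
    exact hle (hx i)

theorem isFace_prodSet {C F : Fin (n + 1) → Set (EuclideanSpace ℝ (Fin d))}
    (hF : ∀ i, IsFace (C i) (F i)) : IsFace (prodSet C) (prodSet F) := by
  choose z hz hFz using hF
  refine ⟨WithLp.toLp 2 z, fun x hx => ?_, ?_⟩
  · rw [PiLp.inner_apply]
    exact Finset.sum_nonpos fun i _ => hz i _ (hx i)
  · ext x
    change (∀ i, x i ∈ F i) ↔ (∀ i, x i ∈ C i) ∧ inner ℝ x (WithLp.toLp 2 z) = 0
    simp only [hFz, PiLp.inner_apply]
    constructor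
    · exact fun h => ⟨fun i => (h i).1, Finset.sum_eq_zero fun i _ => (h i).2⟩
    · rintro ⟨hx, hsum⟩ i
      exact ⟨hx i, (Finset.sum_eq_zero_iff_of_nonpos fun j _ => hz j _ (hx j)).1 hsum i
        (Finset.mem_univ i)⟩

/-- Testing `z` on vectors supported in one factor shows that each component `z i` supports `C i`.
-/
theorem exists_prodSet_of_isFace {C : Fin (n + 1) → Set (EuclideanSpace ℝ (Fin d))}
    (h0 : ∀ i, 0 ∈ C i) {F : Set (PiLp 2 fun _ : Fin (n + 1) => EuclideanSpace ℝ (Fin d))}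
    (hF : IsFace (prodSet C) F) :
    ∃ G : Fin (n + 1) → Set (EuclideanSpace ℝ (Fin d)),
      (∀ i, IsFace (C i) (G i)) ∧ F = prodSet G := by
  obtain ⟨z, hz, rfl⟩ := hF
  have hzi : ∀ i, ∀ x ∈ C i, inner ℝ x (z i) ≤ 0 := fun i x hx => by
    rw [← inner_inclusion]
    exact hz _ (inclusion_mem_prodSet h0 hx)
  refine ⟨fun i => {x ∈ C i | inner ℝ x (z i) = 0}, fun i => ⟨z i, hzi i, rfl⟩, ?_⟩
  ext x
  change (∀ i, x i ∈ C i) ∧ inner ℝ x z = 0 ↔ ∀ i, x i ∈ C i ∧ inner ℝ (x i) (z i) = 0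
  rw [PiLp.inner_apply]
  constructor
  · rintro ⟨hx, hsum⟩ i
    exact ⟨hx i, (Finset.sum_eq_zero_iff_of_nonpos fun j _ => hzi j _ (hx j)).1 hsum i
      (Finset.mem_univ i)⟩
  · exact fun h => ⟨fun i => (h i).1, Finset.sum_eq_zero fun i _ => (h i).2⟩

theorem IsPolyhedralCone.zero_mem {E : Type*} [NormedAddCommGroup E] [InnerProductSpace ℝ E]
    {C : Set E} (hC : IsPolyhedralCone C) : (0 : E) ∈ C := by
  obtain ⟨A, rfl⟩ := hC.exists_coneOf
  exact zero_mem_coneOf A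

theorem piSubmodule_injective :
    Function.Injective (piSubmodule :
      (Fin (n + 1) → Submodule ℝ (EuclideanSpace ℝ (Fin d))) → _) := by
  have hmem : ∀ (L : Fin (n + 1) → Submodule ℝ (EuclideanSpace ℝ (Fin d))) i x,
      x ∈ L i ↔ inclusion d i x ∈ piSubmodule L := fun L i x => by
    refine ⟨fun hx => inclusion_mem_prodSet (F := fun i => (L i : Set (EuclideanSpace ℝ (Fin d))))
      (fun j => (L j).zero_mem) hx,
      fun hx => ?_⟩
    have := hx i
    rwa [inclusion_apply, if_pos rfl] at this
  intro L L' h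
  funext i
  ext x
  rw [hmem L, hmem L', h]

theorem bijOn_piSubmodule {C : Fin (n + 1) → Set (EuclideanSpace ℝ (Fin d))}
    (hC : ∀ i, IsPolyhedralCone (C i)) (m : ℕ) :
    Set.BijOn piSubmodule (spanTuples m C) (faceSpans m (prodSet C)) := by
  have h0 := fun i => (hC i).zero_mem
  refine ⟨?_, piSubmodule_injective.injOn, ?_⟩
  · rintro L ⟨hL, hsum⟩
    refine ⟨?_, by rw [finrank_piSubmodule, hsum]⟩
    choose F hF hspan using hL
    refine ⟨prodSet F, isFace_prodSet hF, ?_⟩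
    rw [span_prodSet fun i => zero_mem_of_isFace (h0 i) (hF i)]
    simp only [hspan]
  · rintro _ ⟨⟨F, hF, rfl⟩, hdim⟩
    obtain ⟨G, hG, rfl⟩ := exists_prodSet_of_isFace h0 hF
    rw [span_prodSet fun i => zero_mem_of_isFace (h0 i) (hG i)] at hdim ⊢
    exact ⟨_, ⟨fun i => ⟨G i, hG i, rfl⟩, by rw [← hdim, finrank_piSubmodule]⟩, rfl⟩

theorem polyMeasure_prodSet_eq_finsum {C M : Fin (n + 1) → Set (EuclideanSpace ℝ (Fin d))}
    (hC : ∀ i, IsPolyhedralCone (C i)) (hM : ∀ i, MeasurableSet (M i)) (m : ℕ) :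
    polyMeasure m (prodSet C) (prodSet M)
      = ∑ᶠ L ∈ spanTuples m C, ∏ i, gaussOn (L i) (C i ∩ M i) := by
  refine (finsum_mem_eq_of_bijOn _ (bijOn_piSubmodule hC m) fun L _ => ?_).symm
  rw [← gaussOn_piSubmodule L fun i => (hC i).isConicBorel.1.inter (hM i)]
  congr 1
  ext x
  exact forall_and

/-- Expand the product of sums over face spans and group the tuples by their vector of dimensions.
-/
theorem sum_prod_polyMeasure {E : Type*} [NormedAddCommGroup E] [InnerProductSpace ℝ E]
    [FiniteDimensional ℝ E] [MeasurableSpace E] {C M : Fin (n + 1) → Set E}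
    (hC : ∀ i, IsPolyhedralCone (C i)) (m : ℕ) :
    ∑ j ∈ Finset.Nat.antidiagonalTuple (n + 1) m, ∏ i, polyMeasure (j i) (C i) (M i)
      = ∑ᶠ L ∈ spanTuples m C, ∏ i, gaussOn (L i) (C i ∩ M i) := by
  classical
  let S : Fin (n + 1) → Finset (Submodule ℝ E) := fun i => (finite_allSpans (hC i)).toFinset
  have hpoly : ∀ i k, polyMeasure k (C i) (M i)
      = ∑ L ∈ (S i).filter (fun L : Submodule ℝ E => Module.finrank ℝ L = k),
          gaussOn L (C i ∩ M i) := fun i k => by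
    rw [← finsum_mem_coe_finset]
    refine finsum_mem_congr ?_ fun _ _ => rfl
    ext L
    simp [S, mem_faceSpans_iff]
  rw [finsum_mem_eq_finite_toFinset_sum _ (finite_spanTuples m hC)]
  simp_rw [hpoly, Finset.prod_univ_sum]
  rw [← Finset.sum_fiberwise_of_maps_to (g := fun L : Fin (n + 1) → Submodule ℝ E =>
    fun i => Module.finrank ℝ (L i)) (t := Finset.Nat.antidiagonalTuple (n + 1) m)]
  · refine Finset.sum_congr rfl fun j hj => Finset.sum_congr ?_ fun _ _ => rfl
    rw [Finset.Nat.mem_antidiagonalTuple] at hj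
    ext L
    simp only [S, Fintype.mem_piFinset, Finset.mem_filter, Set.Finite.mem_toFinset, spanTuples,
      Set.mem_ofPred_eq]
    constructor
    · intro h
      exact ⟨⟨fun i => (h i).1, by simp [h, hj]⟩, funext fun i => (h i).2⟩
    · rintro ⟨⟨h, -⟩, rfl⟩ i
      exact ⟨h i, rfl⟩
  · intro L hL
    rw [Finset.Nat.mem_antidiagonalTuple]
    exact ((Set.Finite.mem_toFinset _).1 hL).2

end Product

/-! ### Assembly of the kinematic formula. -/

section Kinematic

variable {d n k : ℕ}

theorem bijOn_map_moveEquiv (T : Fin (n + 1) → GL (Fin d) ℝ)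
    (C : Fin (n + 1) → Set (EuclideanSpace ℝ (Fin d))) (Q : Fin (n + 1) → OGroup d) (m : ℕ) :
    Set.BijOn (fun (L : Fin (n + 1) → Submodule ℝ (EuclideanSpace ℝ (Fin d))) i =>
        (L i).map (moveEquiv (T i) (Q i) : _ →ₗ[ℝ] EuclideanSpace ℝ (Fin d)))
      (spanTuples m C) (spanTuples m fun i => move (T i) (Q i) (C i)) := by
  have hdim : ∀ i (K : Submodule ℝ (EuclideanSpace ℝ (Fin d))), Module.finrank ℝ
      (K.map (moveEquiv (T i) (Q i) : _ →ₗ[ℝ] EuclideanSpace ℝ (Fin d))) = Module.finrank ℝ K :=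
    fun i K => LinearEquiv.finrank_map_eq (moveEquiv (T i) (Q i)).toLinearEquiv K
  refine ⟨?_, ?_, ?_⟩
  · rintro L ⟨hL, hsum⟩
    refine ⟨fun i => ?_, ?_⟩
    · beta_reduce
      rw [move_eq_image]
      exact map_mem_allSpans_image (hL i) _
    · simp only [hdim, hsum]
  · intro L _ L' _ h
    funext i
    exact Submodule.map_injective_of_injective (moveEquiv (T i) (Q i)).injective (congrFun h i)
  · rintro K ⟨hK, hsum⟩
    have : ∀ i, ∃ L ∈ allSpans (C i), K i
        = L.map (moveEquiv (T i) (Q i) : _ →ₗ[ℝ] EuclideanSpace ℝ (Fin d)) := fun i =>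
      exists_map_of_mem_allSpans_image _ (move_eq_image (T i) (Q i) (C i) ▸ hK i)
    choose L hL hKL using this
    obtain rfl : K = _ := funext hKL
    refine ⟨L, ⟨hL, ?_⟩, rfl⟩
    simpa only [hdim] using hsum

theorem ae_polyMeasure_iInter_move (hk : 0 < k)
    {C : Fin (n + 1) → Set (EuclideanSpace ℝ (Fin d))} (hC : ∀ i, IsPolyhedralCone (C i))
    (M : Fin (n + 1) → Set (EuclideanSpace ℝ (Fin d))) (T : Fin (n + 1) → GL (Fin d) ℝ) :
    ∀ᵐ Q ∂uniformTuple (Fin (n + 1)) d,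
      polyMeasure k (⋂ i, move (T i) (Q i) (C i)) (⋂ i, move (T i) (Q i) (M i))
        = ∑ L ∈ (finite_spanTuples (n * d + k) hC).toFinset,
          gaussOn (movedInter T L Q) {x | ∀ i, pullback (T i) (Q i) x ∈ C i ∩ M i} := by
  have hfin : {L : Fin (n + 1) → Submodule ℝ (EuclideanSpace ℝ (Fin d)) |
      ∀ i, L i ∈ allSpans (C i)}.Finite := Set.Finite.pi' fun i => finite_allSpans (hC i)
  -- There are finitely many pairs of tuples, so one null set handles all of them; the intersections
  -- `L i ⊓ L' i` are needed for the uniqueness of tuples.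
  have hae : ∀ᵐ Q ∂uniformTuple (Fin (n + 1)) d,
      ∀ L ∈ {L : Fin (n + 1) → Submodule ℝ (EuclideanSpace ℝ (Fin d)) |
        ∀ i, L i ∈ allSpans (C i)},
      ∀ L' ∈ {L : Fin (n + 1) → Submodule ℝ (EuclideanSpace ℝ (Fin d)) |
        ∀ i, L i ∈ allSpans (C i)},
      Module.finrank ℝ (movedInter T (fun i => L i ⊓ L' i) Q)
        = ∑ i, Module.finrank ℝ (L i ⊓ L' i : Submodule ℝ (EuclideanSpace ℝ (Fin d))) - n * d := by
    rw [Filter.eventually_all_finite hfin]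
    intro L _
    rw [Filter.eventually_all_finite hfin]
    exact fun L' _ => ae_finrank_movedInter T fun i => L i ⊓ L' i
  filter_upwards [hae] with Q hQ
  have hset : (⋂ i, move (T i) (Q i) (C i)) ∩ (⋂ i, move (T i) (Q i) (M i))
      = {x | ∀ i, pullback (T i) (Q i) x ∈ C i ∩ M i} := by
    ext x
    simp only [Set.mem_inter_iff, Set.mem_iInter, mem_move_iff]
    exact forall_and.symm
  have hCQ : ∀ i, IsPolyhedralCone (move (T i) (Q i) (C i)) := fun i => by
    rw [move_eq_image]
    exact (hC i).image _
  rw [polyMeasure, hset, finsum_faceSpans_iInter hCQ hk (N := n * d) ?_ _ ?_,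
    ← finsum_mem_eq_of_bijOn _ (bijOn_map_moveEquiv T C Q (n * d + k)) fun L _ => rfl,
    finsum_mem_eq_finite_toFinset_sum _ (finite_spanTuples (n * d + k) hC)]
  · exact Finset.sum_congr rfl fun L _ => by rw [iInf_map_moveEquiv]
  · intro K K' hK hK'
    have hex : ∀ K : Fin (n + 1) → Submodule ℝ (EuclideanSpace ℝ (Fin d)),
        (∀ i, K i ∈ allSpans (move (T i) (Q i) (C i))) → ∃ L ∈
        {L : Fin (n + 1) → Submodule ℝ (EuclideanSpace ℝ (Fin d)) | ∀ i, L i ∈ allSpans (C i)},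
        K = fun i => (L i).map (moveEquiv (T i) (Q i) : _ →ₗ[ℝ] EuclideanSpace ℝ (Fin d)) := by
      intro K hK
      obtain ⟨L, hL, hLK⟩ := (bijOn_map_moveEquiv T C Q _).surjOn ⟨hK, rfl⟩
      exact ⟨L, hL.1, hLK.symm⟩
    obtain ⟨L, hL, rfl⟩ := hex K hK
    obtain ⟨L', hL', rfl⟩ := hex K' hK'
    have hinf : ∀ i, (L i).map (moveEquiv (T i) (Q i) : _ →ₗ[ℝ] EuclideanSpace ℝ (Fin d)) ⊓
        (L' i).map (moveEquiv (T i) (Q i) : _ →ₗ[ℝ] EuclideanSpace ℝ (Fin d))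
        = (L i ⊓ L' i).map (moveEquiv (T i) (Q i) : _ →ₗ[ℝ] EuclideanSpace ℝ (Fin d)) :=
      fun i => (Submodule.map_inf _ (moveEquiv (T i) (Q i)).injective).symm
    rw [iInf_congr hinf, iInf_map_moveEquiv T fun i => L i ⊓ L' i, hQ L hL L' hL']
    congr 1
    refine Finset.sum_congr rfl fun i _ => ?_
    rw [hinf i]
    exact (LinearEquiv.finrank_map_eq (moveEquiv (T i) (Q i)).toLinearEquiv _).symm
  · intro L hL
    refine le_antisymm (Submodule.span_le.2 Set.inter_subset_right) ?_
    conv_lhs => rw [← span_eq_of_gaussOn_ne_zero hL]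
    rw [← hset]
    exact Submodule.span_mono (Set.inter_subset_inter_left _ Set.inter_subset_left)

/-- The kinematic formula for the polyhedral measures, under the product Haar measure. -/
theorem kinematic_uniformTuple (hk : 0 < k)
    {C M : Fin (n + 1) → Set (EuclideanSpace ℝ (Fin d))} (hC : ∀ i, IsPolyhedralCone (C i))
    (hM : ∀ i, IsConicBorel (M i)) (T : Fin (n + 1) → GL (Fin d) ℝ) :
    Integrable (fun Q : Fin (n + 1) → OGroup d =>
        polyMeasure k (⋂ i, move (T i) (Q i) (C i)) (⋂ i, move (T i) (Q i) (M i)))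
      (uniformTuple (Fin (n + 1)) d) ∧
    ∫ Q : Fin (n + 1) → OGroup d,
        polyMeasure k (⋂ i, move (T i) (Q i) (C i)) (⋂ i, move (T i) (Q i) (M i))
      ∂uniformTuple (Fin (n + 1)) d = polyMeasure (n * d + k) (prodSet C) (prodSet M) := by
  have hCM : ∀ i, IsConicBorel (C i ∩ M i) := fun i => (hC i).isConicBorel.inter (hM i)
  have hae := ae_polyMeasure_iInter_move hk hC M T
  have hint := fun L => integrable_gaussOn_movedInter T L fun i => (hCM i).1
  constructor
  · exact (integrable_congr hae).2 (integrable_finsetSum _ fun L _ => hint L)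
  · rw [integral_congr_ae hae, integral_finsetSum _ fun L _ => hint L,
      polyMeasure_prodSet_eq_finsum hC (fun i => (hM i).1),
      finsum_mem_eq_finite_toFinset_sum _ (finite_spanTuples (n * d + k) hC)]
    exact Finset.sum_congr rfl fun L hL =>
      integral_gaussOn_movedInter hk T ((Set.Finite.mem_toFinset _).1 hL).2 hCM

/-- Both claims depend only on the joint law of the `Q i`, which independence identifies with the
product of Haar measures. -/
theorem kinematic_random (hk : 0 < k)
    {C M : Fin (n + 1) → Set (EuclideanSpace ℝ (Fin d))} (hC : ∀ i, IsPolyhedralCone (C i))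
    (hM : ∀ i, IsConicBorel (M i)) (T : Fin (n + 1) → GL (Fin d) ℝ)
    {Ω : Type*} [MeasurableSpace Ω] {P : Measure Ω} [IsProbabilityMeasure P]
    {Q : Fin (n + 1) → Ω → OGroup d} (hlaw : ∀ i, HasLaw (Q i) (uniformO d) P)
    (hindep : iIndepFun Q P) :
    Integrable (fun ω =>
        polyMeasure k (⋂ i, move (T i) (Q i ω) (C i)) (⋂ i, move (T i) (Q i ω) (M i))) P ∧
    ∫ ω, polyMeasure k (⋂ i, move (T i) (Q i ω) (C i)) (⋂ i, move (T i) (Q i ω) (M i)) ∂P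
      = polyMeasure (n * d + k) (prodSet C) (prodSet M) := by
  have hQ : AEMeasurable (fun ω i => Q i ω) P := aemeasurable_pi_lambda _ fun i =>
    (hlaw i).aemeasurable
  have hmap : P.map (fun ω i => Q i ω) = uniformTuple (Fin (n + 1)) d := by
    rw [hindep.map_fun_eq_pi_map fun i => (hlaw i).aemeasurable]
    simp only [(hlaw _).map_eq]
  obtain ⟨hint, heq⟩ := kinematic_uniformTuple hk hC hM T
  rw [← hmap] at hint heq
  rw [integral_map hQ hint.aestronglyMeasurable] at heq
  exact ⟨(integrable_map_measure hint.aestronglyMeasurable hQ).1 hint, heq⟩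

theorem uVector_eq_polyMeasure {E : Type*} [NormedAddCommGroup E] [InnerProductSpace ℝ E]
    [FiniteDimensional ℝ E] [MeasurableSpace E] (k : ℕ) (C : Set E) :
    uVector k C = polyMeasure k C Set.univ := by
  simp only [uVector, polyMeasure, Set.inter_univ]

theorem iInter_move_univ (T : Fin (n + 1) → GL (Fin d) ℝ) (Q : Fin (n + 1) → OGroup d) :
    ⋂ i, move (T i) (Q i) Set.univ = Set.univ :=
  Set.eq_univ_of_forall fun _ => Set.mem_iInter.2 fun _ => mem_move_iff.2 trivial

theorem prodSet_univ : prodSet (fun _ : Fin (n + 1) =>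
    (Set.univ : Set (EuclideanSpace ℝ (Fin d)))) = Set.univ :=
  Set.eq_univ_of_forall fun _ _ => trivial

end Kinematic

end ConicKinematic

end

theorem mainTheorem6 {d n k : ℕ} (hk : 0 < k)
    (C M : Fin (n + 1) → Set (EuclideanSpace ℝ (Fin d)))
    (hC : ∀ i, ConicKinematic.IsPolyhedralCone (C i))
    (hM : ∀ i, ConicKinematic.IsConicBorel (M i))
    (T : Fin (n + 1) → GL (Fin d) ℝ)
    {Ω : Type*} [MeasurableSpace Ω] (P : Measure Ω) [IsProbabilityMeasure P]
    (Q : Fin (n + 1) → Ω → ConicKinematic.OGroup d)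
    (hlaw : ∀ i, HasLaw (Q i) (ConicKinematic.uniformO d) P)
    (hindep : iIndepFun Q P) :
    -- the kinematic formula for the polyhedral measures
    (Integrable (fun ω => ConicKinematic.polyMeasure k
        (⋂ i, ConicKinematic.move (T i) (Q i ω) (C i))
        (⋂ i, ConicKinematic.move (T i) (Q i ω) (M i))) P ∧
      ∫ ω, ConicKinematic.polyMeasure k
        (⋂ i, ConicKinematic.move (T i) (Q i ω) (C i))
        (⋂ i, ConicKinematic.move (T i) (Q i ω) (M i)) ∂P
      = ConicKinematic.polyMeasure (n * d + k)
        (ConicKinematic.prodSet C) (ConicKinematic.prodSet M)) ∧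
    -- the polyhedral measures of the product
    (∀ m : ℕ, ConicKinematic.polyMeasure m
        (ConicKinematic.prodSet C) (ConicKinematic.prodSet M)
      = ∑ j ∈ Finset.Nat.antidiagonalTuple (n + 1) m,
          ∏ i, ConicKinematic.polyMeasure (j i) (C i) (M i)) ∧
    -- the kinematic formula for the `u`-vector
    (Integrable (fun ω => ConicKinematic.uVector k
        (⋂ i, ConicKinematic.move (T i) (Q i ω) (C i))) P ∧
      ∫ ω, ConicKinematic.uVector k
        (⋂ i, ConicKinematic.move (T i) (Q i ω) (C i)) ∂P
      = ConicKinematic.uVector (n * d + k) (ConicKinematic.prodSet C)) := by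
  refine ⟨ConicKinematic.kinematic_random hk hC hM T hlaw hindep, fun m => ?_, ?_⟩
  · rw [ConicKinematic.polyMeasure_prodSet_eq_finsum hC fun i => (hM i).1,
      ConicKinematic.sum_prod_polyMeasure hC]
  -- The `u`-vector is the case in which every `M i` is the whole space.
  · have h := ConicKinematic.kinematic_random hk hC
      (fun _ => ConicKinematic.isConicBorel_univ) T hlaw hindep
    simp only [ConicKinematic.iInter_move_univ, ConicKinematic.prodSet_univ] at h
    simpa only [ConicKinematic.uVector_eq_polyMeasure] using h
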